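/- Let $E$ be a separable Banach space and, for $\Omega\subset E$, let $\beta(\Omega)$ be the Hausdorff measure of noncompactness, i.e. the infimum of all $r>0$ such that $\Omega$ can be covered by finitely many balls of radius $r$. Let $\{A(\lambda):D(A(\lambda))\to E\}_{\lambda\in[0,1]}$ be a family of densely defined linear operators such that (A1) for every $\lambda\in[0,1]$, $-A(\lambda)$ is the infinitesimal generator of a $C_0$ semigroup $\{S_{A(\lambda)}(t)\}_{t\ge 0}$ of bounded linear operators on $E$, and there is $\omega>0$ such that $\|S_{A(\lambda)}(t)\|\le e^{-\omega t}$ for all $t\ge 0$ and $\lambda\in[0,1]$; (A2) if $\lambda_n\to\lambda_0$ in $[0,1]$, then $(\nu I+A(\lambda_n))^{-1}u\to(\nu I+A(\lambda_0))^{-1}u$ for every $\nu>-\omega$ and $u\in E$. Let $T>0$, put $J=[0,T]$, and let $F:J\times E\times[0,1]\to E$ be a continuous map such that (F1) for every $x\in E$ there are $\delta_x,L_x>0$ with $\|F(t,x_1,\lambda)-F(t,x_2,\lambda)\|\le L_x\|x_1-x_2\|$ for all $x_1,x_2\in B(x,\delta_x)$, $t\in J$, $\lambda\in[0,1]$; (F2)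 there is $c>0$ with $\|F(t,x,\lambda)\|\le c(1+\|x\|)$ for all $t\in J$, $x\in E$, $\lambda\in[0,1]$; (F3) there is $k\ge 0$ with $\beta(F(J\times\Omega\times[0,1]))\le k\,\beta(\Omega)$ for every bounded $\Omega\subset E$. A mild solution on $J$ of $\dot u(t)=-A(\lambda)u(t)+F(t,u(t),\lambda)$ with $u(0)=x$ is a continuous function $u:J\to E$ such that $u(t)=S_{A(\lambda)}(t)x+\int_0^t S_{A(\lambda)}(t-\tau)F(\tau,u(\tau),\lambda)\,d\tau$ for all $t\in J$. Then: (i) (Existence) For every $x\in E$ and $\lambda\in[0,1]$ there is a unique mild solution $u(\cdot;0,T,x,\lambda)$ on $[0,T]$ with $u(0)=x$. The same holds for $T=+\infty$, that is, with $J=[0,+\infty)$ in the assumptions on $F$ and in the notion of mild solution. (ii) (Continuity) If $(x_n,\lambda_n)\to(x_0,\lambda_0)$ in $E\times[0,1]$, then $u(\cdot;0,T,x_n,\lambda_n)\to u(\cdot;0,T,x_0,\lambda_0)$ in $C([0,T],E)$. (iii) (Compactness) If $\Phi_t(x,\lambda):=u(t;0,T,x,\lambda)$ for $t\in[0,T]$,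 then $\beta(\Phi_t(\Omega\times[0,1]))\le e^{(k-\omega)t}\beta(\Omega)$ for every $t\in[0,T]$ and every bounded $\Omega\subset E$. -/

import Mathlib

open Set Filter Topology MeasureTheory
open scoped unitInterval ENNReal

noncomputable section

namespace EvolutionFamily

variable {E : Type*} [NormedAddCommGroup E] [NormedSpace ℝ E]

/-- The Hausdorff measure of noncompactness: the infimum of all `r > 0` such that `Ω` is covered by
finitely many balls of radius `r`. It takes values in `[0, ∞]`, and is `∞` exactly for unbounded
sets. -/
def hausdorffMNC (Ω : Set E) : ℝ≥0∞ :=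
  ⨅ (r : ℝ) (_ : 0 < r ∧ ∃ s : Set E, s.Finite ∧ Ω ⊆ ⋃ c ∈ s, Metric.ball c r), ENNReal.ofReal r

/-- A `C₀` semigroup of bounded linear operators; only the values `S t` with `t ≥ 0` matter. -/
structure IsC0Semigroup (S : ℝ → E →L[ℝ] E) : Prop where
  map_zero : S 0 = ContinuousLinearMap.id ℝ E
  map_add : ∀ s t : ℝ, 0 ≤ s → 0 ≤ t → S (s + t) = (S s).comp (S t)
  tendsto_zero : ∀ x : E, Tendsto (fun t : ℝ => S t x) (𝓝[>] 0) (𝓝 x)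

/-- `G` is the infinitesimal generator of `S`: the domain of `G` consists of those `x` for which
`(S h x - x) / h` has a limit as `h → 0⁺`, and `G x` is that limit. -/
def IsInfinitesimalGenerator (G : E →ₗ.[ℝ] E) (S : ℝ → E →L[ℝ] E) : Prop :=
  ∀ x y : E, (x, y) ∈ G.graph ↔ Tendsto (fun h : ℝ => h⁻¹ • (S h x - x)) (𝓝[>] 0) (𝓝 y)

open Classical in
/-- The resolvent `R(ν : G) u = (ν I - G)⁻¹ u`: the unique `x` in the domain of `G` such that
`ν x - G x = u`. (It is set to `0` when there is no such unique `x`, which never happens for `ν` in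
the resolvent set of `G`.) -/
def resolventOp (G : E →ₗ.[ℝ] E) (ν : ℝ) (u : E) : E :=
  if h : ∃! x : G.domain, ν • (x : E) - G x = u then ((h.choose : G.domain) : E) else 0

/-- Resolvent continuity of a family of operators `A(lam)`, where `-A(lam)` has all `ν > -ω` in its
resolvent set: `R(ν : -A(lₙ)) u → R(ν : -A(l₀)) u` whenever `lₙ → l₀`. -/
def ResolventContinuous (A : I → E →ₗ.[ℝ] E) (ω : ℝ) : Prop :=
  ∀ (l : ℕ → I) (l₀ : I), Tendsto l atTop (𝓝 l₀) → ∀ ν : ℝ, -ω < ν → ∀ u : E,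
    Tendsto (fun n => resolventOp (-(A (l n))) ν u) atTop (𝓝 (resolventOp (-(A l₀)) ν u))

/-- The conditions on the perturbation `F(t, x, lam)`, with `t` in the time interval `J`. -/
structure IsPerturbation (F : ℝ × E × I → E) (J : Set ℝ) (k : ℝ) : Prop where
  continuousOn : ContinuousOn F (J ×ˢ univ)
  locallyLipschitz : ∀ x : E, ∃ δ > 0, ∃ L > 0, ∀ x₁ ∈ Metric.ball x δ, ∀ x₂ ∈ Metric.ball x δ,
    ∀ t ∈ J, ∀ lam : I, ‖F (t, x₁, lam) - F (t, x₂, lam)‖ ≤ L * ‖x₁ - x₂‖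
  linearGrowth : ∃ c > 0, ∀ x : E, ∀ t ∈ J, ∀ lam : I, ‖F (t, x, lam)‖ ≤ c * (1 + ‖x‖)
  k_nonneg : 0 ≤ k
  setContraction : ∀ Ω : Set E, Bornology.IsBounded Ω →
    hausdorffMNC (F '' (J ×ˢ Ω ×ˢ univ)) ≤ ENNReal.ofReal k * hausdorffMNC Ω

/-- `u` is a mild solution on the time interval `J` (equal to `[0, T]` or `[0, ∞)`) of
`u' = -A u + F(t, u, lam)`, `u(0) = x`, where `S` is the semigroup generated by `-A`. -/
def IsMildSolution (S : ℝ → E →L[ℝ] E) (F : ℝ × E × I → E) (lam : I) (J : Set ℝ) (x : E)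
    (u : ℝ → E) : Prop :=
  ContinuousOn u J ∧
    ∀ t ∈ J, u t = S t x + ∫ τ in (0 : ℝ)..t, S (t - τ) (F (τ, u τ, lam))

end EvolutionFamily

end

/-! Because every semigroup decays at rate `ω > 0`, the point `ν = 0` lies in the resolvent set of
each generator and the resolvent there is `R u = ∫₀^∞ S t u dt`. Strong continuity of the parameter
dependence of `R` passes to the semigroups by a Trotter–Kato argument, so `(lam, t, x) ↦ S lam t x`
is jointly continuous (`continuous_semigroupFamily_of_resolventContinuous`).

From then on only the integral equation `u = S x + S * F(u)` matters, with contractions `S`. The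
Lipschitz condition gives local existence by Banach's fixed point theorem
(`IsVolterraSolution.exists_extension`) and uniqueness by Grönwall's inequality; linear growth gives
an a priori bound that excludes blow-up (`exists_isVolterraSolution_of_forall_lt`). Grönwall's
inequality near the compact trajectory of one solution gives continuous dependence
(`continuous_volterraSolution`).

For compactness, separability gives the formula `β(a) = inf_m sup_i dist(a_i, E_m)` for bounded
families, with `E_m` an increasing sequence of finite-dimensional subspaces with dense union. It
yields `β(∫ f) ≤ ∫ β(f)` (`hausdorffMNC_range_integral_le`). With `g(t) = β(Φ_t(Ω × [0,1]))` the
integral equation becomes `g(t) ≤ e^{-ωt} β(Ω) + ∫₀ᵗ e^{-ω(t-τ)} k g(τ) dτ`, and Grönwall's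
inequality for `e^{ωt} g(t)` finishes the proof. -/

namespace EvolutionFamily

/-! ### One exponentially decaying semigroup and its resolvent at zero. -/

section Semigroup

variable {E : Type*} [NormedAddCommGroup E] [NormedSpace ℝ E] {S : ℝ → E →L[ℝ] E} {ω : ℝ}

/-- The extension of a semigroup to all real times which is the identity for negative times. -/
noncomputable def extendSemigroup (S : ℝ → E →L[ℝ] E) (t : ℝ) : E →L[ℝ] E := S (max t 0)

theorem extendSemigroup_of_nonneg {t : ℝ} (ht : 0 ≤ t) : extendSemigroup S t = S t := by
  rw [extendSemigroup, max_eq_left ht]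

theorem norm_extendSemigroup_le_one (hω : 0 < ω)
    (hc : ∀ t : ℝ, 0 ≤ t → ‖S t‖ ≤ Real.exp (-ω * t)) (t : ℝ) : ‖extendSemigroup S t‖ ≤ 1 := by
  refine (hc _ (le_max_right t 0)).trans (Real.exp_le_one_iff.2 ?_)
  nlinarith [mul_nonneg hω.le (le_max_right t 0)]

theorem norm_extendSemigroup_apply_le (hω : 0 < ω)
    (hc : ∀ t : ℝ, 0 ≤ t → ‖S t‖ ≤ Real.exp (-ω * t)) (t : ℝ) (x : E) :
    ‖extendSemigroup S t x‖ ≤ ‖x‖ := by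
  simpa using (extendSemigroup S t).le_of_opNorm_le (norm_extendSemigroup_le_one hω hc t) x

/-- The semigroup law and contractivity bound `‖S b x - S a x‖` by `‖S |b - a| x - x‖`, so right
continuity at `0` gives two-sided continuity everywhere. -/
theorem continuous_extendSemigroup_apply (hS : IsC0Semigroup S) (hω : 0 < ω)
    (hc : ∀ t : ℝ, 0 ≤ t → ‖S t‖ ≤ Real.exp (-ω * t)) (x : E) :
    Continuous fun t => extendSemigroup S t x := by
  set ρ : ℝ → ℝ := fun h => ‖extendSemigroup S h x - x‖ with hρ
  have hρ0 : Tendsto ρ (𝓝 0) (𝓝 0) := by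
    suffices hsup : Tendsto ρ (𝓝[≤] 0 ⊔ 𝓝[>] 0) (𝓝 0) by rwa [nhdsLE_sup_nhdsGT] at hsup
    refine tendsto_sup.2 ⟨?_, ?_⟩
    · refine tendsto_const_nhds.congr' ?_
      filter_upwards [self_mem_nhdsWithin] with h hh
      simp [hρ, extendSemigroup, max_eq_right (mem_Iic.1 hh), hS.map_zero]
    · have h1 := (hS.tendsto_zero x).sub_const x
      rw [sub_self] at h1
      refine (tendsto_zero_iff_norm_tendsto_zero.1 h1).congr' ?_
      filter_upwards [self_mem_nhdsWithin] with h hh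
      simp [hρ, extendSemigroup_of_nonneg (mem_Ioi.1 hh).le]
  have key : ∀ a b : ℝ, 0 ≤ a → a ≤ b → ‖S b x - S a x‖ ≤ ρ (b - a) := by
    intro a b ha hab
    have : S b x = S a (S (b - a) x) := by
      have := hS.map_add a (b - a) ha (sub_nonneg.2 hab)
      rw [add_sub_cancel] at this
      rw [this]; rfl
    rw [this, ← map_sub, hρ]
    simp only [extendSemigroup_of_nonneg (sub_nonneg.2 hab)]
    rw [← extendSemigroup_of_nonneg (S := S) ha]
    exact norm_extendSemigroup_apply_le hω hc _ _
  have key2 : ∀ a b : ℝ, 0 ≤ a → 0 ≤ b → ‖S b x - S a x‖ ≤ ρ |b - a| := by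
    intro a b ha hb
    rcases le_total a b with h | h
    · rw [abs_of_nonneg (sub_nonneg.2 h)]; exact key a b ha h
    · rw [abs_sub_comm, abs_of_nonneg (sub_nonneg.2 h), norm_sub_rev]; exact key b a hb h
  rw [continuous_iff_continuousAt]
  intro t
  rw [ContinuousAt, tendsto_iff_norm_sub_tendsto_zero]
  refine squeeze_zero (fun _ => norm_nonneg _)
    (fun s => key2 (max t 0) (max s 0) (le_max_right _ _) (le_max_right _ _)) ?_
  refine hρ0.comp ?_
  have : Continuous fun s : ℝ => |max s 0 - max t 0| := by fun_prop
  simpa using this.tendsto t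

theorem continuous_extendSemigroup_uncurry (hS : IsC0Semigroup S) (hω : 0 < ω)
    (hc : ∀ t : ℝ, 0 ≤ t → ‖S t‖ ≤ Real.exp (-ω * t)) :
    Continuous fun p : ℝ × E => extendSemigroup S p.1 p.2 := by
  rw [continuous_iff_continuousAt]
  rintro ⟨t, x⟩
  have h1 : Tendsto (fun p : ℝ × E => extendSemigroup S p.1 (p.2 - x)) (𝓝 (t, x)) (𝓝 0) := by
    refine squeeze_zero_norm (fun p => norm_extendSemigroup_apply_le hω hc p.1 _) ?_
    have : Continuous fun p : ℝ × E => ‖p.2 - x‖ := by fun_prop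
    simpa using this.tendsto (t, x)
  have h2 : Tendsto (fun p : ℝ × E => extendSemigroup S p.1 x) (𝓝 (t, x))
      (𝓝 (extendSemigroup S t x)) :=
    ((continuous_extendSemigroup_apply hS hω hc x).comp continuous_fst).tendsto (t, x)
  have := h1.add h2
  simpa [ContinuousAt] using this

theorem integrableOn_semigroup (hS : IsC0Semigroup S) (hω : 0 < ω)
    (hc : ∀ t : ℝ, 0 ≤ t → ‖S t‖ ≤ Real.exp (-ω * t)) (u : E) :
    IntegrableOn (fun t => S t u) (Ioi 0) := by
  have h1 : IntegrableOn (fun t => Real.exp (-ω * t) * ‖u‖) (Ioi 0) :=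
    (exp_neg_integrableOn_Ioi 0 hω).mul_const _
  refine Integrable.mono' h1 ?_ ?_
  · refine ContinuousOn.aestronglyMeasurable ?_ measurableSet_Ioi
    refine (continuous_extendSemigroup_apply hS hω hc u).continuousOn.congr fun t ht => ?_
    simp only [extendSemigroup_of_nonneg (mem_Ioi.1 ht).le]
  · filter_upwards [ae_restrict_mem measurableSet_Ioi] with t ht
    exact (S t).le_of_opNorm_le (hc t (mem_Ioi.1 ht).le) u

theorem exists_clm_eq_integral_semigroup (hS : IsC0Semigroup S) (hω : 0 < ω)
    (hc : ∀ t : ℝ, 0 ≤ t → ‖S t‖ ≤ Real.exp (-ω * t)) :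
    ∃ R : E →L[ℝ] E, (∀ u, R u = ∫ t in Ioi (0 : ℝ), S t u) ∧ ∀ u, ‖R u‖ ≤ ω⁻¹ * ‖u‖ := by
  have hi := integrableOn_semigroup hS hω hc
  let R₀ : E →ₗ[ℝ] E :=
    { toFun := fun u => ∫ t in Ioi (0 : ℝ), S t u
      map_add' := fun u v => by simp only [map_add]; exact integral_add (hi u) (hi v)
      map_smul' := fun a u => by simp only [map_smul, RingHom.id_apply]; exact integral_smul a _ }
  have hb : ∀ u, ‖R₀ u‖ ≤ ω⁻¹ * ‖u‖ := by
    intro u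
    have h1 : ‖∫ t in Ioi (0 : ℝ), S t u‖ ≤ ∫ t in Ioi (0 : ℝ), Real.exp (-ω * t) * ‖u‖ := by
      refine norm_integral_le_of_norm_le ((exp_neg_integrableOn_Ioi 0 hω).mul_const _) ?_
      filter_upwards [ae_restrict_mem measurableSet_Ioi] with t ht
      exact (S t).le_of_opNorm_le (hc t (mem_Ioi.1 ht).le) u
    rw [integral_mul_const, integral_exp_mul_Ioi (by linarith)] at h1
    have h2 : -Real.exp (-ω * 0) / -ω = ω⁻¹ := by simp [neg_div_neg_eq]
    rwa [h2] at h1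
  exact ⟨R₀.mkContinuous ω⁻¹ hb, fun u => rfl, hb⟩

/-- The orbit of such a `z` has zero right derivative, hence is constant; then `S 1 z = z`, while
`‖S 1‖ ≤ e^{-ω} < 1`. This is the injectivity of the generator. -/
theorem eq_zero_of_tendsto_difference_quotient_zero (hS : IsC0Semigroup S) (hω : 0 < ω)
    (hc : ∀ t : ℝ, 0 ≤ t → ‖S t‖ ≤ Real.exp (-ω * t)) {z : E}
    (hz : Tendsto (fun h : ℝ => h⁻¹ • (S h z - z)) (𝓝[>] 0) (𝓝 0)) : z = 0 := by
  have hder : ∀ t ∈ Ico (0 : ℝ) 1, HasDerivWithinAt (fun s => extendSemigroup S s z) 0 (Ici t) t := by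
    intro t ht
    rw [← hasDerivWithinAt_Ioi_iff_Ici, hasDerivWithinAt_iff_tendsto_slope' (by simp)]
    have h1 : Tendsto (fun h : ℝ => S t (h⁻¹ • (S h z - z))) (𝓝[>] 0) (𝓝 0) := by
      have h := ((S t).continuous.tendsto 0).comp hz
      rwa [map_zero] at h
    have h2 : Tendsto (fun s : ℝ => s - t) (𝓝[>] t) (𝓝[>] 0) := by
      refine tendsto_nhdsWithin_iff.2 ⟨?_, ?_⟩
      · have : Continuous fun s : ℝ => s - t := by fun_prop
        simpa using (this.tendsto t).mono_left nhdsWithin_le_nhds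
      · filter_upwards [self_mem_nhdsWithin] with s hs
        exact mem_Ioi.2 (sub_pos.2 hs)
    refine (h1.comp h2).congr' ?_
    filter_upwards [self_mem_nhdsWithin] with s hs
    have hs' : t < s := hs
    have h3 := hS.map_add t (s - t) ht.1 (sub_nonneg.2 hs'.le)
    rw [add_sub_cancel] at h3
    simp only [Function.comp, slope, vsub_eq_sub, map_smul, map_sub,
      extendSemigroup_of_nonneg ht.1, extendSemigroup_of_nonneg (ht.1.trans hs'.le), h3,
      ContinuousLinearMap.comp_apply]
  have h4 := constant_of_has_deriv_right_zero
    (continuous_extendSemigroup_apply hS hω hc z).continuousOn hder 1 (by simp)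
  rw [extendSemigroup_of_nonneg zero_le_one, extendSemigroup_of_nonneg le_rfl, hS.map_zero] at h4
  have h5 := (S 1).le_of_opNorm_le (hc 1 zero_le_one) z
  rw [h4] at h5
  have h6 : Real.exp (-ω * 1) < 1 := by rw [Real.exp_lt_one_iff]; linarith
  by_contra hne
  have := norm_pos_iff.2 hne
  simp only [ContinuousLinearMap.id_apply] at h5
  nlinarith

variable {R : E →L[ℝ] E} [CompleteSpace E]

theorem semigroup_apply_integral (hS : IsC0Semigroup S) (hω : 0 < ω)
    (hc : ∀ t : ℝ, 0 ≤ t → ‖S t‖ ≤ Real.exp (-ω * t))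
    (hR : ∀ u, R u = ∫ t in Ioi (0 : ℝ), S t u) {h : ℝ} (hh : 0 ≤ h) (u : E) :
    S h (R u) = R u - ∫ r in (0 : ℝ)..h, extendSemigroup S r u := by
  have hi := integrableOn_semigroup hS hω hc u
  have h1 : S h (R u) = ∫ t in Ioi h, S t u := by
    rw [hR, ← (S h).integral_comp_comm hi]
    have h2 := (measurePreserving_add_left (volume : Measure ℝ) h).setIntegral_preimage_emb
      (measurableEmbedding_addLeft h) (fun t => S t u) (Ioi h)
    rw [← h2]
    simp only [preimage_const_add_Ioi, sub_self]
    refine setIntegral_congr_fun measurableSet_Ioi fun t ht => ?_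
    simp only [hS.map_add h t hh (mem_Ioi.1 ht).le]
    rfl
  have h3 := intervalIntegral.integral_Ioi_sub_Ioi hi hh
  have h4 : ∫ r in (0 : ℝ)..h, extendSemigroup S r u = ∫ r in (0 : ℝ)..h, S r u := by
    refine intervalIntegral.integral_congr fun r hr => ?_
    rw [uIcc_of_le hh] at hr
    simp only [extendSemigroup_of_nonneg hr.1]
  rw [h1, h4, ← h3, hR]
  abel

theorem integral_semigroup_comm (hS : IsC0Semigroup S) (hω : 0 < ω)
    (hc : ∀ t : ℝ, 0 ≤ t → ‖S t‖ ≤ Real.exp (-ω * t))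
    (hR : ∀ u, R u = ∫ t in Ioi (0 : ℝ), S t u) {h : ℝ} (hh : 0 ≤ h) (u : E) :
    S h (R u) = R (S h u) := by
  rw [hR, hR, ← (S h).integral_comp_comm (integrableOn_semigroup hS hω hc u)]
  refine setIntegral_congr_fun measurableSet_Ioi fun t ht => ?_
  have h1 := hS.map_add h t hh (mem_Ioi.1 ht).le
  have h2 := hS.map_add t h (mem_Ioi.1 ht).le hh
  rw [add_comm, h1] at h2
  exact congrArg (fun L : E →L[ℝ] E => L u) h2

theorem hasDerivAt_integral_extendSemigroup (hS : IsC0Semigroup S) (hω : 0 < ω)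
    (hc : ∀ t : ℝ, 0 ≤ t → ‖S t‖ ≤ Real.exp (-ω * t)) (u : E) (t : ℝ) :
    HasDerivAt (fun s => ∫ r in (0 : ℝ)..s, extendSemigroup S r u) (extendSemigroup S t u) t :=
  (continuous_extendSemigroup_apply hS hω hc u).integral_hasStrictDerivAt 0 t |>.hasDerivAt

theorem hasDerivAt_extendSemigroup_integral (hS : IsC0Semigroup S) (hω : 0 < ω)
    (hc : ∀ t : ℝ, 0 ≤ t → ‖S t‖ ≤ Real.exp (-ω * t))
    (hR : ∀ u, R u = ∫ t in Ioi (0 : ℝ), S t u) (u : E) {t : ℝ} (ht : 0 < t) :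
    HasDerivAt (fun s => extendSemigroup S s (R u)) (-extendSemigroup S t u) t := by
  refine ((hasDerivAt_integral_extendSemigroup hS hω hc u t).const_sub (R u)).congr_of_eventuallyEq ?_
  filter_upwards [lt_mem_nhds ht] with s hs
  rw [extendSemigroup_of_nonneg hs.le, semigroup_apply_integral hS hω hc hR hs.le]

/-- Since `S h (R u) = ∫_h^∞ S t u dt`, only the integral over `[0, h]` is lost. In terms of the
generator `G`, this says `G (R u) = -u`. -/
theorem tendsto_difference_quotient_integral (hS : IsC0Semigroup S) (hω : 0 < ω)
    (hc : ∀ t : ℝ, 0 ≤ t → ‖S t‖ ≤ Real.exp (-ω * t))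
    (hR : ∀ u, R u = ∫ t in Ioi (0 : ℝ), S t u) (u : E) :
    Tendsto (fun h : ℝ => h⁻¹ • (S h (R u) - R u)) (𝓝[>] 0) (𝓝 (-u)) := by
  have h1 := hasDerivAt_iff_tendsto_slope.1 (hasDerivAt_integral_extendSemigroup hS hω hc u 0)
  have h2 : Tendsto (slope (fun s => ∫ r in (0 : ℝ)..s, extendSemigroup S r u) 0) (𝓝[>] 0)
      (𝓝 u) := by
    have : extendSemigroup S 0 u = u := by simp [extendSemigroup, hS.map_zero]
    rw [this] at h1
    exact h1.mono_left (nhdsWithin_mono _ fun x hx => (mem_Ioi.1 hx).ne')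
  refine h2.neg.congr' ?_
  filter_upwards [self_mem_nhdsWithin] with h hh
  rw [semigroup_apply_integral hS hω hc hR (mem_Ioi.1 hh).le]
  simp [slope]

/-- `R` commutes with `S h`, so the quotients converging to `-x` in the preceding limit are
themselves values of `R`. -/
theorem denseRange_integral_semigroup (hS : IsC0Semigroup S) (hω : 0 < ω)
    (hc : ∀ t : ℝ, 0 ≤ t → ‖S t‖ ≤ Real.exp (-ω * t))
    (hR : ∀ u, R u = ∫ t in Ioi (0 : ℝ), S t u) : DenseRange R := by
  intro x
  refine mem_closure_of_tendsto
    (by simpa using (tendsto_difference_quotient_integral hS hω hc hR x).neg) ?_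
  filter_upwards [self_mem_nhdsWithin] with h hh
  refine ⟨-(h⁻¹ • (S h x - x)), ?_⟩
  rw [map_neg, map_smul, map_sub, integral_semigroup_comm hS hω hc hR (mem_Ioi.1 hh).le]

theorem resolventOp_zero_eq (hS : IsC0Semigroup S) (hω : 0 < ω)
    (hc : ∀ t : ℝ, 0 ≤ t → ‖S t‖ ≤ Real.exp (-ω * t))
    (hR : ∀ u, R u = ∫ t in Ioi (0 : ℝ), S t u) {G : E →ₗ.[ℝ] E}
    (hG : IsInfinitesimalGenerator G S) (u : E) : resolventOp G 0 u = R u := by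
  have h1 : (R u, -u) ∈ G.graph :=
    (hG _ _).2 (tendsto_difference_quotient_integral hS hω hc hR u)
  obtain ⟨x, hx, hx'⟩ := LinearPMap.mem_graph_iff _ |>.1 h1
  simp only at hx hx'
  have huniq : ∀ y : G.domain, (0 : ℝ) • (y : E) - G y = u → y = x := by
    intro y hy
    have h2 : (((y - x : G.domain) : E), (0 : E)) ∈ G.graph := by
      rw [LinearPMap.mem_graph_iff]
      refine ⟨y - x, rfl, ?_⟩
      rw [LinearPMap.map_sub, hx', ← hy]
      simp
    have h3 := eq_zero_of_tendsto_difference_quotient_zero hS hω hc ((hG _ _).1 h2)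
    exact sub_eq_zero.1 (Subtype.ext h3)
  have hex : ∃! x : G.domain, (0 : ℝ) • (x : E) - G x = u :=
    ⟨x, by simp [hx'], huniq⟩
  rw [resolventOp, dif_pos hex, huniq _ hex.choose_spec.1, hx]

/-- Orbits starting in the range of `R` are Lipschitz in time, with a constant that does not depend
on the semigroup. -/
theorem norm_extendSemigroup_integral_sub_le (hS : IsC0Semigroup S) (hω : 0 < ω)
    (hc : ∀ t : ℝ, 0 ≤ t → ‖S t‖ ≤ Real.exp (-ω * t))
    (hR : ∀ u, R u = ∫ t in Ioi (0 : ℝ), S t u) (u : E) (s t : ℝ) :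
    ‖extendSemigroup S s (R u) - extendSemigroup S t (R u)‖ ≤ ‖u‖ * |s - t| := by
  have hi := fun a b => (continuous_extendSemigroup_apply hS hω hc u).intervalIntegrable
    (μ := volume) a b
  have h1 : extendSemigroup S s (R u) - extendSemigroup S t (R u) =
      ∫ r in (max s 0)..(max t 0), extendSemigroup S r u := by
    simp only [extendSemigroup.eq_1 S s, extendSemigroup.eq_1 S t]
    rw [semigroup_apply_integral hS hω hc hR (le_max_right s 0),
      semigroup_apply_integral hS hω hc hR (le_max_right t 0),
      ← intervalIntegral.integral_interval_sub_left (hi 0 (max t 0)) (hi 0 (max s 0))]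
    abel
  rw [h1]
  refine (intervalIntegral.norm_integral_le_of_norm_le_const
    fun r _ => norm_extendSemigroup_apply_le hω hc r u).trans ?_
  rw [abs_sub_comm]
  exact mul_le_mul_of_nonneg_left (abs_max_sub_max_le_abs _ _ _) (norm_nonneg u)

/-- Integrate the derivative of `ψ s = S' (t - s) R' S s R u` over `[0, t]`. It equals `S' (t - s)
(R - R') S s u`, so two semigroups are compared through their resolvents alone. -/
theorem norm_resolvent_comm_sub_le {S' : ℝ → E →L[ℝ] E} {R' : E →L[ℝ] E}
    (hS : IsC0Semigroup S) (hS' : IsC0Semigroup S') (hω : 0 < ω)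
    (hc : ∀ t : ℝ, 0 ≤ t → ‖S t‖ ≤ Real.exp (-ω * t))
    (hc' : ∀ t : ℝ, 0 ≤ t → ‖S' t‖ ≤ Real.exp (-ω * t))
    (hR : ∀ u, R u = ∫ t in Ioi (0 : ℝ), S t u) (hR' : ∀ u, R' u = ∫ t in Ioi (0 : ℝ), S' t u)
    {t : ℝ} (ht : 0 ≤ t) (u : E) :
    ‖R' (S t (R u)) - S' t (R' (R u))‖ ≤
      ∫ s in (0 : ℝ)..t, ‖R (extendSemigroup S s u) - R' (extendSemigroup S s u)‖ := by
  have hj := continuous_extendSemigroup_uncurry hS hω hc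
  have hj' := continuous_extendSemigroup_uncurry hS' hω hc'
  have hcont : ∀ v : E, Continuous fun s => extendSemigroup S s v :=
    continuous_extendSemigroup_apply hS hω hc
  set ψ : ℝ → E := fun s => extendSemigroup S' (t - s) (R' (extendSemigroup S s (R u))) with hψ
  set ψ' : ℝ → E := fun s => extendSemigroup S' (t - s)
    (R (extendSemigroup S s u) - R' (extendSemigroup S s u)) with hψ'
  have hψc : Continuous ψ := by
    have h1 : Continuous fun s => (t - s, R' (extendSemigroup S s (R u))) :=
      (by fun_prop : Continuous fun s => t - s).prodMk (R'.continuous.comp (hcont _))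
    exact hj'.comp h1
  have hdc : Continuous fun s => R (extendSemigroup S s u) - R' (extendSemigroup S s u) :=
    (R.continuous.comp (hcont _)).sub (R'.continuous.comp (hcont _))
  have hψ'c : Continuous ψ' :=
    hj'.comp ((by fun_prop : Continuous fun s => t - s).prodMk hdc)
  have hder : ∀ s ∈ Ioo 0 t, HasDerivAt ψ (ψ' s) s := by
    intro s hs
    have hy := hasDerivAt_extendSemigroup_integral hS hω hc hR u hs.1
    have hB : HasDerivAt (fun s' => extendSemigroup S' (t - s') (R' (extendSemigroup S s (R u))))
        (extendSemigroup S' (t - s) (extendSemigroup S s (R u))) s := by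
      have := (hasDerivAt_extendSemigroup_integral hS' hω hc' hR' (extendSemigroup S s (R u))
        (sub_pos.2 hs.2)).scomp s ((hasDerivAt_id s).const_sub t)
      simpa [Function.comp_def] using this
    rw [hasDerivAt_iff_tendsto_slope] at hy hB ⊢
    -- Product rule by hand: `hB` differentiates the outer semigroup with its argument frozen at
    -- `s`; here the inner orbit varies while the outer time moves along, which needs joint
    -- continuity.
    have h1 : Tendsto (fun s' => extendSemigroup S' (t - s')
        (R' (slope (fun s => extendSemigroup S s (R u)) s s'))) (𝓝[≠] s)
        (𝓝 (extendSemigroup S' (t - s) (R' (-extendSemigroup S s u)))) := by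
      have h2 : Tendsto (fun s' => t - s') (𝓝[≠] s) (𝓝 (t - s)) :=
        ((by fun_prop : Continuous fun s' => t - s').tendsto s).mono_left nhdsWithin_le_nhds
      exact (hj'.tendsto _).comp (h2.prodMk_nhds ((R'.continuous.tendsto _).comp hy))
    have h3 := h1.add hB
    have h4 : extendSemigroup S' (t - s) (R' (-extendSemigroup S s u)) +
        extendSemigroup S' (t - s) (extendSemigroup S s (R u)) = ψ' s := by
      rw [hψ', ← map_add, map_neg]
      simp only [extendSemigroup_of_nonneg (S := S) hs.1.le]
      rw [integral_semigroup_comm hS hω hc hR hs.1.le, neg_add_eq_sub]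
    rw [h4] at h3
    refine h3.congr fun s' => ?_
    simp only [slope, vsub_eq_sub, map_smul, map_sub, hψ, ← smul_add]
    congr 1
    abel
  have h5 := intervalIntegral.integral_eq_sub_of_hasDerivAt_of_le ht hψc.continuousOn hder
    (hψ'c.intervalIntegrable 0 t)
  have h6 : ψ t - ψ 0 = R' (S t (R u)) - S' t (R' (R u)) := by
    simp [hψ, extendSemigroup_of_nonneg ht, extendSemigroup_of_nonneg le_rfl, hS.map_zero,
      hS'.map_zero]
  rw [← h6, ← h5]
  refine (intervalIntegral.norm_integral_le_integral_norm ht).trans ?_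
  refine intervalIntegral.integral_mono_on ht (hψ'c.norm.intervalIntegrable _ _)
    (hdc.norm.intervalIntegrable _ _) fun s _ => ?_
  exact norm_extendSemigroup_apply_le hω hc' _ _

end Semigroup

/-! ### Joint continuity in parameter, time and initial point. -/

section Family

variable {E : Type*} [NormedAddCommGroup E] [NormedSpace ℝ E] [CompleteSpace E] {ω : ℝ}

/-- The Trotter–Kato theorem for a continuous family of resolvents. -/
theorem continuous_semigroupFamily {X : Type*} [TopologicalSpace X] [FirstCountableTopology X]
    {S : X → ℝ → E →L[ℝ] E} {R : X → E →L[ℝ] E}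
    (hS : ∀ lam, IsC0Semigroup (S lam)) (hω : 0 < ω)
    (hc : ∀ lam, ∀ t : ℝ, 0 ≤ t → ‖S lam t‖ ≤ Real.exp (-ω * t))
    (hR : ∀ lam u, R lam u = ∫ t in Ioi (0 : ℝ), S lam t u)
    (hRb : ∀ lam u, ‖R lam u‖ ≤ ω⁻¹ * ‖u‖)
    (hRc : ∀ u, Continuous fun lam => R lam u) :
    Continuous fun p : X × ℝ × E => extendSemigroup (S p.1) p.2.1 p.2.2 := by
  rw [continuous_iff_continuousAt]
  rintro ⟨l, t, x⟩
  have hV : ∀ lam t x, ‖extendSemigroup (S lam) t x‖ ≤ ‖x‖ :=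
    fun lam => norm_extendSemigroup_apply_le hω (hc lam)
  set V := fun (lam : X) => extendSemigroup (S lam) with hVdef
  -- Vectors `R l (R l u)` are used because the commutator estimate consumes both resolvents. They
  -- are dense, and uniform contractivity carries the convergence over to all of `E`.
  have hrange : ∀ u : E, Tendsto (fun p : X × ℝ => V p.1 p.2 (R l (R l u))) (𝓝 (l, t))
      (𝓝 (V l t (R l (R l u)))) := by
    intro u
    set w := R l u with hw
    set t' := max t 0 with ht'
    rw [tendsto_iff_norm_sub_tendsto_zero]
    have hbound : ∀ p : X × ℝ, ‖V p.1 p.2 (R l w) - V l t (R l w)‖ ≤ ‖R l w - R p.1 w‖ +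
        ‖w‖ * |p.2 - t| + (∫ s in (0 : ℝ)..t', ‖R l (V l s u) - R p.1 (V l s u)‖) +
        ‖R p.1 (V l t w) - R l (V l t w)‖ := by
      rintro ⟨m, s⟩
      -- Four errors: replacing `R l` by `R m`, changing the time on the range of `R m`, commuting
      -- the resolvent past the two semigroups, and replacing `R m` by `R l` again.
      have e1 : V m s (R l w) - V l t (R l w) = V m s (R l w - R m w) +
          (V m s (R m w) - V m t (R m w)) - (R m (V l t w) - V m t (R m w)) +
          (R m (V l t w) - R l (V l t w)) := by
        have : V l t (R l w) = R l (V l t w) :=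
          integral_semigroup_comm (hS l) hω (hc l) (hR l) (le_max_right t 0) w
        rw [this, map_sub]
        abel
      rw [e1]
      refine (norm_add_le _ _).trans (add_le_add_left ?_ _)
      refine (norm_sub_le _ _).trans (add_le_add ((norm_add_le _ _).trans (add_le_add ?_ ?_)) ?_)
      · exact hV _ _ _
      · exact norm_extendSemigroup_integral_sub_le (hS m) hω (hc m) (hR m) w s t
      · exact norm_resolvent_comm_sub_le (hS l) (hS m) hω (hc l) (hc m) (hR l) (hR m)
          (le_max_right t 0) u
    refine squeeze_zero (fun _ => norm_nonneg _) hbound ?_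
    have hfst : Tendsto (fun p : X × ℝ => p.1) (𝓝 (l, t)) (𝓝 l) := continuous_fst.tendsto _
    have hRl : ∀ v, Tendsto (fun p : X × ℝ => R p.1 v) (𝓝 (l, t)) (𝓝 (R l v)) :=
      fun v => ((hRc v).tendsto l).comp hfst
    have h1 : Tendsto (fun p : X × ℝ => ‖R l w - R p.1 w‖) (𝓝 (l, t)) (𝓝 0) := by
      simpa using ((hRl w).const_sub (R l w)).norm
    have h2 : Tendsto (fun p : X × ℝ => ‖w‖ * |p.2 - t|) (𝓝 (l, t)) (𝓝 0) := by
      have : Continuous fun p : X × ℝ => ‖w‖ * |p.2 - t| := by fun_prop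
      simpa using this.tendsto (l, t)
    have h4 : Tendsto (fun p : X × ℝ => ‖R p.1 (V l t w) - R l (V l t w)‖) (𝓝 (l, t)) (𝓝 0) := by
      simpa using ((hRl (V l t w)).sub_const (R l (V l t w))).norm
    have hVc : Continuous fun s => V l s u := continuous_extendSemigroup_apply (hS l) hω (hc l) u
    have h3 : Tendsto (fun p : X × ℝ => ∫ s in (0 : ℝ)..t', ‖R l (V l s u) - R p.1 (V l s u)‖)
        (𝓝 (l, t)) (𝓝 0) := by
      have := intervalIntegral.tendsto_integral_filter_of_dominated_convergence (μ := volume)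
        (a := 0) (b := t') (l := 𝓝 (l, t)) (f := fun _ => (0 : ℝ))
        (F := fun (p : X × ℝ) s => ‖R l (V l s u) - R p.1 (V l s u)‖)
        (fun _ => ω⁻¹ * ‖u‖ + ω⁻¹ * ‖u‖)
        (Eventually.of_forall fun p => by
          have : Continuous fun s => ‖R l (V l s u) - R p.1 (V l s u)‖ := by fun_prop
          exact this.aestronglyMeasurable)
        (Eventually.of_forall fun p => Eventually.of_forall fun s _ => by
          rw [norm_norm]
          have hb : ∀ m, ‖R m (V l s u)‖ ≤ ω⁻¹ * ‖u‖ := fun m =>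
            (hRb m _).trans (mul_le_mul_of_nonneg_left (hV _ _ _) (inv_nonneg.2 hω.le))
          exact (norm_sub_le _ _).trans (add_le_add (hb _) (hb _)))
        intervalIntegrable_const
        (Eventually.of_forall fun s _ => by
          simpa using ((hRl (V l s u)).const_sub (R l (V l s u))).norm)
      simpa using this
    simpa using ((h1.add h2).add h3).add h4
  have hdense : DenseRange fun u => R l (R l u) :=
    (denseRange_integral_semigroup (hS l) hω (hc l) (hR l)).comp
      (denseRange_integral_semigroup (hS l) hω (hc l) (hR l)) (R l).continuous
  rw [ContinuousAt, Metric.tendsto_nhds]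
  intro ε hε
  obtain ⟨u, hu⟩ := Metric.denseRange_iff.1 hdense x (ε / 4) (by linarith)
  set z := R l (R l u) with hz
  have hA : ∀ᶠ p : X × ℝ × E in 𝓝 (l, t, x), dist (V p.1 p.2.1 z) (V l t z) < ε / 4 := by
    have hproj : Tendsto (fun p : X × ℝ × E => (p.1, p.2.1)) (𝓝 (l, t, x)) (𝓝 (l, t)) :=
      (by fun_prop : Continuous fun p : X × ℝ × E => (p.1, p.2.1)).tendsto _
    exact hproj.eventually (Metric.tendsto_nhds.1 (hrange u) (ε / 4) (by linarith))
  have hB : ∀ᶠ p : X × ℝ × E in 𝓝 (l, t, x), dist p.2.2 x < ε / 4 := by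
    have hproj : Tendsto (fun p : X × ℝ × E => p.2.2) (𝓝 (l, t, x)) (𝓝 x) :=
      (by fun_prop : Continuous fun p : X × ℝ × E => p.2.2).tendsto _
    exact Metric.tendsto_nhds.1 hproj (ε / 4) (by linarith)
  filter_upwards [hA, hB] with p hpA hpB
  have e : ∀ m s (y z : E), dist (V m s y) (V m s z) ≤ dist y z := fun m s y z => by
    rw [dist_eq_norm, dist_eq_norm, ← map_sub]; exact hV _ _ _
  calc dist (V p.1 p.2.1 p.2.2) (V l t x)
      ≤ dist (V p.1 p.2.1 p.2.2) (V p.1 p.2.1 x) + dist (V p.1 p.2.1 x) (V p.1 p.2.1 z) +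
        dist (V p.1 p.2.1 z) (V l t z) + dist (V l t z) (V l t x) :=
        (dist_triangle _ _ _).trans (add_le_add_left (dist_triangle4 _ _ _ _) _) |>.trans (by
          linarith)
    _ < ε := by
        have h1 := e p.1 p.2.1 p.2.2 x
        have h2 := e p.1 p.2.1 x z
        have h3 := e l t z x
        rw [dist_comm z x] at h3
        linarith

theorem continuous_semigroupFamily_of_resolventContinuous {A : I → E →ₗ.[ℝ] E}
    {S : I → ℝ → E →L[ℝ] E} (hS : ∀ lam : I, IsC0Semigroup (S lam))
    (hgen : ∀ lam : I, IsInfinitesimalGenerator (-(A lam)) (S lam)) (hω : 0 < ω)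
    (hc : ∀ lam : I, ∀ t : ℝ, 0 ≤ t → ‖S lam t‖ ≤ Real.exp (-ω * t))
    (hres : ResolventContinuous A ω) :
    Continuous fun p : I × ℝ × E => extendSemigroup (S p.1) p.2.1 p.2.2 := by
  choose R hR hRb using fun lam => exists_clm_eq_integral_semigroup (hS lam) hω (hc lam)
  refine continuous_semigroupFamily hS hω hc hR hRb fun u => ?_
  rw [continuous_iff_seqContinuous]
  intro l l₀ hl
  -- The value `ν = 0` is admissible because `-ω < 0`.
  have := hres l l₀ hl 0 (by linarith) u
  simpa only [Function.comp_def,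
    resolventOp_zero_eq (hS _) hω (hc _) (hR _) (hgen _)] using this

end Family

/-- Grönwall's inequality in integral form. -/
theorem le_mul_exp_of_le_add_integral {h : ℝ → ℝ} {a k T : ℝ} (hk : 0 ≤ k)
    (hint : IntegrableOn h (Icc 0 T)) (hh : ∀ t ∈ Icc 0 T, h t ≤ a + k * ∫ τ in (0 : ℝ)..t, h τ) :
    ∀ t ∈ Icc 0 T, h t ≤ a * Real.exp (k * t) := by
  intro t₁ ht₁
  have hT : 0 ≤ T := ht₁.1.trans ht₁.2
  set H : ℝ → ℝ := fun t => a + k * ∫ τ in (0 : ℝ)..t, h τ with hH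
  have hHc : ContinuousOn H (Icc 0 T) := by
    have := intervalIntegral.continuousOn_primitive_interval (a := 0) (b := T) (f := h)
      (μ := volume) (by rwa [uIcc_of_le hT])
    rw [uIcc_of_le hT] at this
    exact continuousOn_const.add (continuousOn_const.mul this)
  -- As `h` is only integrable, the differential argument is run on its continuous majorant `H`.
  -- Extending `H` to `ℝ` makes `K` differentiable everywhere, and `K' = k H ≤ k K` makes `K
  -- e^{-kt}` decrease.
  set H' : ℝ → ℝ := IccExtend hT ((Icc 0 T).domRestrict H) with hH'
  have hH'c : Continuous H' := (continuousOn_iff_continuous_domRestrict.1 hHc).Icc_extend'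
  have hH'eq : ∀ t ∈ Icc 0 T, H' t = H t := fun t ht => IccExtend_of_mem hT _ ht
  set K : ℝ → ℝ := fun t => a + k * ∫ τ in (0 : ℝ)..t, H' τ with hK
  have hHK : ∀ t ∈ Icc 0 T, H t ≤ K t := by
    intro t ht
    have hsub : Icc 0 t ⊆ Icc 0 T := Icc_subset_Icc_right ht.2
    refine add_le_add le_rfl (mul_le_mul_of_nonneg_left ?_ hk)
    refine intervalIntegral.integral_mono_on ht.1 ?_ (hH'c.intervalIntegrable _ _) ?_
    · refine (hint.mono_set ?_).intervalIntegrable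
      rwa [uIcc_of_le ht.1]
    · intro τ hτ
      rw [hH'eq τ (hsub hτ)]
      exact hh τ (hsub hτ)
  have hKd : ∀ t, HasDerivAt K (k * H' t) t := fun t =>
    ((hH'c.integral_hasStrictDerivAt 0 t).hasDerivAt.const_mul k).const_add a
  have hQd : ∀ t, HasDerivAt (fun t => K t * Real.exp (-(k * t)))
      (k * H' t * Real.exp (-(k * t)) + K t * (Real.exp (-(k * t)) * -(k * 1))) t := fun t =>
    (hKd t).mul ((((hasDerivAt_id t).const_mul k).neg).exp)
  have hanti : AntitoneOn (fun t => K t * Real.exp (-(k * t))) (Icc 0 T) := by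
    refine antitoneOn_of_deriv_nonpos (convex_Icc 0 T)
      (fun t _ => (hQd t).continuousAt.continuousWithinAt)
      (fun t _ => (hQd t).differentiableAt.differentiableWithinAt) fun t ht => ?_
    have ht' := interior_subset ht
    rw [(hQd t).deriv, hH'eq t ht']
    have h1 := mul_nonneg (mul_nonneg hk (Real.exp_pos (-(k * t))).le)
      (sub_nonneg.2 (hHK t ht'))
    linarith
  have h2 := hanti (left_mem_Icc.2 hT) ht₁ ht₁.1
  have h3 : K 0 = a := by simp [hK]
  simp only [mul_zero, neg_zero, Real.exp_zero, mul_one, h3] at h2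
  have h4 : K t₁ ≤ a * Real.exp (k * t₁) := by
    rw [Real.exp_neg, ← div_eq_mul_inv, div_le_iff₀ (Real.exp_pos _)] at h2
    exact h2
  exact ((hh t₁ ht₁).trans (hHK t₁ ht₁)).trans h4

/-! ### Existence and uniqueness for the integral equation. -/

section Volterra

variable {E : Type*} [NormedAddCommGroup E]

/-- A family of maps which is locally Lipschitz, uniformly in the index. -/
def UniformlyLocallyLipschitz {ι : Type*} (f : ι → E → E) : Prop :=
  ∀ x : E, ∃ δ > 0, ∃ L > 0, ∀ x₁ ∈ Metric.ball x δ, ∀ x₂ ∈ Metric.ball x δ,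
    ∀ i, ‖f i x₁ - f i x₂‖ ≤ L * ‖x₁ - x₂‖

theorem UniformlyLocallyLipschitz.exists_of_isCompact {ι : Type*} {f : ι → E → E}
    (hf : UniformlyLocallyLipschitz f) {K : Set E} (hK : IsCompact K) :
    ∃ δ > 0, ∃ L ≥ 0, ∀ y ∈ K, ∀ z, ‖z - y‖ < δ → ∀ i, ‖f i z - f i y‖ ≤ L * ‖z - y‖ := by
  refine hK.induction_on
    (p := fun K => ∃ δ > 0, ∃ L ≥ 0, ∀ y ∈ K, ∀ z, ‖z - y‖ < δ → ∀ i, ‖f i z - f i y‖ ≤ L * ‖z - y‖)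
    ⟨1, one_pos, 0, le_rfl, by simp⟩ ?_ ?_ ?_
  · rintro s t hst ⟨δ, hδ, L, hL, h⟩
    exact ⟨δ, hδ, L, hL, fun y hy => h y (hst hy)⟩
  · rintro s t ⟨δ, hδ, L, hL, h⟩ ⟨δ', hδ', L', hL', h'⟩
    refine ⟨min δ δ', lt_min hδ hδ', max L L', le_max_of_le_left hL, ?_⟩
    rintro y (hy | hy) z hz i
    · exact (h y hy z (hz.trans_le (min_le_left _ _)) i).trans
        (mul_le_mul_of_nonneg_right (le_max_left _ _) (norm_nonneg _))
    · exact (h' y hy z (hz.trans_le (min_le_right _ _)) i).trans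
        (mul_le_mul_of_nonneg_right (le_max_right _ _) (norm_nonneg _))
  · intro x _
    obtain ⟨δ, hδ, L, hL, h⟩ := hf x
    refine ⟨Metric.ball x (δ / 2), mem_nhdsWithin_of_mem_nhds (Metric.ball_mem_nhds x (half_pos hδ)),
      δ / 2, half_pos hδ, L, hL.le, fun y hy z hz i => h z ?_ y ?_ i⟩
    · have h1 := mem_ball_iff_norm.1 hy
      have h2 := norm_add_le (z - y) (y - x)
      rw [sub_add_sub_cancel] at h2
      exact mem_ball_iff_norm.2 (by linarith)
    · exact Metric.ball_subset_ball (by linarith) hy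

/-- A continuity argument: the Lipschitz bound holds only while `u` is `δ`-close to `v`, but up to a
first exit time Grönwall's inequality keeps the distance below `ε e^{LT} < δ`, so there is no exit.
-/
theorem norm_sub_le_of_norm_sub_le_add_integral {f : ℝ → E → E} {u v : ℝ → E} {T : ℝ}
    (hf : Continuous fun p : ℝ × E => f p.1 p.2)
    (hu : Continuous u) (hv : Continuous v) {δ L ε : ℝ} (hL : 0 ≤ L) (hε : 0 ≤ ε)
    (hLip : ∀ t ∈ Icc 0 T, ∀ z, ‖z - v t‖ < δ → ‖f t z - f t (v t)‖ ≤ L * ‖z - v t‖)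
    (hεδ : ε * Real.exp (L * T) < δ)
    (huv : ∀ t ∈ Icc 0 T, ‖u t - v t‖ ≤ ε + ∫ τ in (0 : ℝ)..t, ‖f τ (u τ) - f τ (v τ)‖) :
    ∀ t ∈ Icc 0 T, ‖u t - v t‖ ≤ ε * Real.exp (L * T) := by
  have hg : Continuous fun t => ‖u t - v t‖ := (hu.sub hv).norm
  have hc : Continuous fun τ => ‖f τ (u τ) - f τ (v τ)‖ :=
    ((hf.comp (continuous_id.prodMk hu)).sub (hf.comp (continuous_id.prodMk hv))).norm
  have step : ∀ t₁ ∈ Icc 0 T, (∀ τ ∈ Ico 0 t₁, ‖u τ - v τ‖ < δ) →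
      ‖u t₁ - v t₁‖ ≤ ε * Real.exp (L * T) := by
    intro t₁ ht₁ hlt
    have h1 : ∀ t ∈ Icc 0 t₁, ‖u t - v t‖ ≤ ε + L * ∫ τ in (0 : ℝ)..t, ‖u τ - v τ‖ := by
      intro t ht
      refine (huv t ⟨ht.1, ht.2.trans ht₁.2⟩).trans (add_le_add le_rfl ?_)
      rw [← intervalIntegral.integral_const_mul]
      refine intervalIntegral.integral_mono_on_of_le_Ioo ht.1 (hc.intervalIntegrable _ _)
        ((hg.const_mul L).intervalIntegrable _ _) fun τ hτ => ?_
      have hτ' : τ < t₁ := hτ.2.trans_le ht.2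
      exact hLip τ ⟨hτ.1.le, hτ'.le.trans ht₁.2⟩ _ (hlt τ ⟨hτ.1.le, hτ'⟩)
    have h2 := le_mul_exp_of_le_add_integral hL hg.continuousOn.integrableOn_Icc h1 t₁
      (right_mem_Icc.2 ht₁.1)
    exact h2.trans (mul_le_mul_of_nonneg_left
      (Real.exp_le_exp.2 (mul_le_mul_of_nonneg_left ht₁.2 hL)) hε)
  have hlt : ∀ t ∈ Icc 0 T, ‖u t - v t‖ < δ := by
    by_contra! hne
    obtain ⟨t, ht, hδt⟩ := hne
    have hcomp : IsCompact (Icc 0 T ∩ {t | δ ≤ ‖u t - v t‖}) :=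
      isCompact_Icc.inter_right (isClosed_le continuous_const hg)
    obtain ⟨t₁, ht₁, hmin⟩ := hcomp.exists_isLeast ⟨t, ht, hδt⟩
    have := step t₁ ht₁.1 fun τ hτ => by
      by_contra! hτδ
      exact absurd (hmin ⟨⟨hτ.1, hτ.2.le.trans ht₁.1.2⟩, hτδ⟩) (not_le.2 hτ.2)
    exact absurd (ht₁.2 : δ ≤ _) (not_le.2 (this.trans_lt hεδ))
  exact fun t ht => step t ht fun τ hτ => hlt τ ⟨hτ.1, hτ.2.le.trans ht.2⟩

variable [NormedSpace ℝ E]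

/-- The right-hand side of the variation of constants formula. -/
noncomputable def volterraMap (W : ℝ → E →L[ℝ] E) (f : ℝ → E → E) (x : E) (u : ℝ → E) (t : ℝ) : E :=
  W t x + ∫ τ in (0 : ℝ)..t, W (t - τ) (f τ (u τ))

/-- A continuous solution of the integral equation `u = volterraMap W f x u` on `[0, T]`. -/
def IsVolterraSolution (W : ℝ → E →L[ℝ] E) (f : ℝ → E → E) (x : E) (T : ℝ) (u : ℝ → E) : Prop :=
  Continuous u ∧ ∀ t ∈ Icc 0 T, u t = volterraMap W f x u t

variable {W : ℝ → E →L[ℝ] E} {f : ℝ → E → E} {x : E} {u v : ℝ → E} {T : ℝ}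

theorem IsVolterraSolution.mono (hu : IsVolterraSolution W f x T u) {T' : ℝ} (h : T' ≤ T) :
    IsVolterraSolution W f x T' u :=
  ⟨hu.1, fun t ht => hu.2 t ⟨ht.1, ht.2.trans h⟩⟩

theorem volterraMap_congr {t : ℝ} (ht : 0 ≤ t) (h : EqOn u v (Icc 0 t)) :
    volterraMap W f x u t = volterraMap W f x v t := by
  unfold volterraMap
  congr 1
  refine intervalIntegral.integral_congr fun τ hτ => ?_
  rw [uIcc_of_le ht] at hτ
  simp only [h hτ]

theorem continuous_volterra_integrand (hW : Continuous fun p : ℝ × E => W p.1 p.2)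
    (hf : Continuous fun p : ℝ × E => f p.1 p.2) (hu : Continuous u) (t : ℝ) :
    Continuous fun τ => W (t - τ) (f τ (u τ)) :=
  hW.comp ((by fun_prop : Continuous fun τ => t - τ).prodMk (hf.comp (continuous_id.prodMk hu)))

theorem continuous_volterraMap (hW : Continuous fun p : ℝ × E => W p.1 p.2)
    (hf : Continuous fun p : ℝ × E => f p.1 p.2) (hu : Continuous u) :
    Continuous (volterraMap W f x u) := by
  refine (hW.comp (continuous_id.prodMk continuous_const)).add ?_
  refine intervalIntegral.continuous_parametric_intervalIntegral_of_continuous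
    (f := fun t τ => W (t - τ) (f τ (u τ))) ?_ continuous_id
  exact hW.comp ((by fun_prop : Continuous fun p : ℝ × ℝ => p.1 - p.2).prodMk
    (hf.comp (continuous_snd.prodMk (hu.comp continuous_snd))))

theorem norm_volterraMap_sub_le (hW : Continuous fun p : ℝ × E => W p.1 p.2)
    (hW1 : ∀ t x, ‖W t x‖ ≤ ‖x‖) (hf : Continuous fun p : ℝ × E => f p.1 p.2)
    (hu : Continuous u) (hv : Continuous v) {t : ℝ} (ht : 0 ≤ t) :
    ‖volterraMap W f x u t - volterraMap W f x v t‖ ≤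
      ∫ τ in (0 : ℝ)..t, ‖f τ (u τ) - f τ (v τ)‖ := by
  have hcu := continuous_volterra_integrand hW hf hu t
  have hcv := continuous_volterra_integrand hW hf hv t
  have hfu : Continuous fun τ => f τ (u τ) := hf.comp (continuous_id.prodMk hu)
  have hfv : Continuous fun τ => f τ (v τ) := hf.comp (continuous_id.prodMk hv)
  rw [volterraMap, volterraMap, add_sub_add_left_eq_sub,
    ← intervalIntegral.integral_sub (hcu.intervalIntegrable _ _) (hcv.intervalIntegrable _ _)]
  refine (intervalIntegral.norm_integral_le_integral_norm ht).trans ?_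
  refine intervalIntegral.integral_mono_on ht ((hcu.sub hcv).norm.intervalIntegrable _ _)
    ((hfu.sub hfv).norm.intervalIntegrable _ _) fun τ _ => ?_
  rw [← map_sub]
  exact hW1 _ _

theorem norm_volterraMap_sub_le_of_eqOn (hW : Continuous fun p : ℝ × E => W p.1 p.2)
    (hW1 : ∀ t x, ‖W t x‖ ≤ ‖x‖) (hf : Continuous fun p : ℝ × E => f p.1 p.2)
    (hu : Continuous u) (hv : Continuous v) (hT : 0 ≤ T) (huv : EqOn u v (Icc 0 T)) {b C : ℝ}
    (hC : ∀ τ ∈ Icc T b, ‖f τ (u τ) - f τ (v τ)‖ ≤ C) {t : ℝ} (ht : t ∈ Icc T b) :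
    ‖volterraMap W f x u t - volterraMap W f x v t‖ ≤ C * (t - T) := by
  refine (norm_volterraMap_sub_le hW hW1 hf hu hv (hT.trans ht.1)).trans ?_
  have hc : Continuous fun τ => ‖f τ (u τ) - f τ (v τ)‖ :=
    ((hf.comp (continuous_id.prodMk hu)).sub (hf.comp (continuous_id.prodMk hv))).norm
  rw [← intervalIntegral.integral_add_adjacent_intervals (hc.intervalIntegrable 0 T)
    (hc.intervalIntegrable T t)]
  have h1 : ∫ τ in (0 : ℝ)..T, ‖f τ (u τ) - f τ (v τ)‖ = 0 := by
    rw [intervalIntegral.integral_congr (g := fun _ => (0 : ℝ))]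
    · simp
    · intro τ hτ
      rw [uIcc_of_le hT] at hτ
      simp [huv hτ]
  have h2 : ∫ τ in T..t, ‖f τ (u τ) - f τ (v τ)‖ ≤ ∫ _ in T..t, C :=
    intervalIntegral.integral_mono_on ht.1 (hc.intervalIntegrable _ _)
      intervalIntegrable_const fun τ hτ => hC τ ⟨hτ.1, hτ.2.trans ht.2⟩
  rw [intervalIntegral.integral_const, smul_eq_mul] at h2
  linarith

theorem IsVolterraSolution.eqOn (hW : Continuous fun p : ℝ × E => W p.1 p.2)
    (hW1 : ∀ t x, ‖W t x‖ ≤ ‖x‖) (hf : Continuous fun p : ℝ × E => f p.1 p.2)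
    (hLip : UniformlyLocallyLipschitz f) (hu : IsVolterraSolution W f x T u)
    (hv : IsVolterraSolution W f x T v) : EqOn u v (Icc 0 T) := by
  intro t ht
  obtain ⟨δ, hδ, L, hL, h⟩ := hLip.exists_of_isCompact
    ((isCompact_Icc (a := 0) (b := T)).image hv.1)
  have := norm_sub_le_of_norm_sub_le_add_integral (T := T) hf hu.1 hv.1 hL le_rfl
    (fun t ht z hz => h _ (mem_image_of_mem v ht) z hz t) (by simpa using hδ)
    (fun t ht => by
      rw [zero_add, hu.2 t ht, hv.2 t ht]
      exact norm_volterraMap_sub_le hW hW1 hf hu.1 hv.1 ht.1) t ht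
  rw [zero_mul] at this
  exact sub_eq_zero.1 (norm_le_zero_iff.1 this)

theorem IsVolterraSolution.norm_le (hW : Continuous fun p : ℝ × E => W p.1 p.2)
    (hW1 : ∀ t x, ‖W t x‖ ≤ ‖x‖) (hf : Continuous fun p : ℝ × E => f p.1 p.2) {c : ℝ} (hc : 0 ≤ c)
    (hgrow : ∀ t y, ‖f t y‖ ≤ c * (1 + ‖y‖)) (hu : IsVolterraSolution W f x T u) :
    ∀ t ∈ Icc 0 T, ‖u t‖ ≤ (‖x‖ + c * T) * Real.exp (c * T) := by
  intro t ht
  have hT : 0 ≤ T := ht.1.trans ht.2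
  have h1 : ∀ t ∈ Icc 0 T, ‖u t‖ ≤ (‖x‖ + c * T) + c * ∫ τ in (0 : ℝ)..t, ‖u τ‖ := by
    intro t ht
    rw [hu.2 t ht, volterraMap]
    have h2 : ‖∫ τ in (0 : ℝ)..t, W (t - τ) (f τ (u τ))‖ ≤
        ∫ τ in (0 : ℝ)..t, (c + c * ‖u τ‖) := by
      refine (intervalIntegral.norm_integral_le_integral_norm ht.1).trans ?_
      refine intervalIntegral.integral_mono_on ht.1
        ((continuous_volterra_integrand hW hf hu.1 t).norm.intervalIntegrable _ _)
        ((continuous_const.add (hu.1.norm.const_mul c)).intervalIntegrable _ _) fun τ _ => ?_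
      exact ((hW1 _ _).trans (hgrow _ _)).trans_eq (by ring)
    rw [intervalIntegral.integral_add intervalIntegrable_const
      ((hu.1.norm.const_mul c).intervalIntegrable _ _), intervalIntegral.integral_const,
      intervalIntegral.integral_const_mul, smul_eq_mul, sub_zero] at h2
    have h3 := hW1 t x
    have h4 : t * c ≤ c * T := by nlinarith [ht.2]
    exact (norm_add_le _ _).trans (by linarith)
  refine (le_mul_exp_of_le_add_integral hc hu.1.norm.continuousOn.integrableOn_Icc h1 t ht).trans ?_
  exact mul_le_mul_of_nonneg_left (Real.exp_le_exp.2 (mul_le_mul_of_nonneg_left ht.2 hc))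
    (add_nonneg (norm_nonneg x) (mul_nonneg hc hT))

/-- Banach's fixed point theorem on a slightly longer interval, among functions that keep the given
past on `[0, T]`; no restart at time `T` is needed. -/
theorem IsVolterraSolution.exists_extension [CompleteSpace E]
    (hW : Continuous fun p : ℝ × E => W p.1 p.2)
    (hW1 : ∀ t x, ‖W t x‖ ≤ ‖x‖) (hf : Continuous fun p : ℝ × E => f p.1 p.2)
    (hLip : UniformlyLocallyLipschitz f) (hT : 0 ≤ T) (hu : IsVolterraSolution W f x T u) :
    ∃ b > T, ∃ v, IsVolterraSolution W f x b v := by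
  obtain ⟨δ, hδ, L, hL, hLz⟩ := hLip (u T)
  set z := u T with hz
  set u' : ℝ → E := fun t => u (min t T) with hu'
  have hu'c : Continuous u' := hu.1.comp (by fun_prop)
  have hu'eq : EqOn u' u (Icc 0 T) := fun t ht => by simp [hu', min_eq_left ht.2]
  have hu'z : ∀ t, T ≤ t → u' t = z := fun t ht => by simp [hu', min_eq_right ht, hz]
  set q := volterraMap W f x u' with hq
  have hqc : Continuous q := continuous_volterraMap hW hf hu'c
  have hqeq : ∀ t ∈ Icc 0 T, q t = u t := fun t ht => by
    rw [hq, volterraMap_congr ht.1 (hu'eq.mono (Icc_subset_Icc_right ht.2)), ← hu.2 t ht]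
  have hqT : q T = z := hqeq T (right_mem_Icc.2 hT)
  obtain ⟨η, hη, hqη⟩ := Metric.continuous_iff.1 hqc T (δ / 4) (by linarith)
  -- The bound `η / 2` keeps `q` within `δ / 4` of `z`. The bound `1 / (2 * L)` makes the map a
  -- `1/2`-contraction and limits the deviation from `q` to `δ / 4`, so that `s` is mapped into
  -- itself.
  set h := min (η / 2) (1 / (2 * L)) with hh
  have hhpos : 0 < h := lt_min (half_pos hη) (by positivity)
  have hhL : L * h ≤ 1 / 2 := by
    have : L * (1 / (2 * L)) = 1 / 2 := by field_simp
    exact this ▸ mul_le_mul_of_nonneg_left (min_le_right _ _) hL.le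
  set b := T + h with hb
  have hTb : T ≤ b := by linarith
  have hb0 : 0 ≤ b := hT.trans hTb
  have hqz : ∀ t ∈ Icc T b, ‖q t - z‖ ≤ δ / 4 := by
    intro t ht
    rw [← hqT, ← dist_eq_norm]
    refine (hqη t ?_).le
    rw [Real.dist_eq, abs_of_nonneg (sub_nonneg.2 ht.1)]
    have : h ≤ η / 2 := min_le_left _ _
    linarith [ht.2]
  let s : Set C(Icc (0 : ℝ) b, E) := {w | (∀ t : Icc (0 : ℝ) b, (t : ℝ) ≤ T → w t = u t) ∧
    ∀ t : Icc (0 : ℝ) b, T ≤ t → ‖w t - z‖ ≤ δ / 2}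
  have hsc : IsClosed s := by
    have : s = (⋂ (t : Icc (0 : ℝ) b) (_ : (t : ℝ) ≤ T), {w : C(Icc (0 : ℝ) b, E) | w t = u t}) ∩
        ⋂ (t : Icc (0 : ℝ) b) (_ : T ≤ t), {w : C(Icc (0 : ℝ) b, E) | ‖w t - z‖ ≤ δ / 2} := by
      ext w; simp [s]
    rw [this]
    refine (isClosed_iInter fun t => isClosed_iInter fun _ => ?_).inter
      (isClosed_iInter fun t => isClosed_iInter fun _ => ?_)
    · exact isClosed_eq (continuous_eval_const t) continuous_const
    · exact isClosed_le ((continuous_eval_const t).sub continuous_const).norm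
        continuous_const
  have hext : ∀ w : C(Icc (0 : ℝ) b, E), Continuous (IccExtend hb0 w) :=
    fun w => w.continuous.Icc_extend'
  have hextT : ∀ w ∈ s, EqOn (IccExtend hb0 w) u (Icc 0 T) := fun w hw t ht => by
    rw [IccExtend_of_mem hb0 w ⟨ht.1, ht.2.trans hTb⟩]
    exact hw.1 _ ht.2
  have hextb : ∀ w ∈ s, ∀ t ∈ Icc T b, ‖IccExtend hb0 w t - z‖ ≤ δ / 2 := fun w hw t ht => by
    rw [IccExtend_of_mem hb0 w ⟨hT.trans ht.1, ht.2⟩]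
    exact hw.2 _ ht.1
  have hball : ∀ {y : E}, ‖y - z‖ ≤ δ / 2 → y ∈ Metric.ball z δ := fun hy =>
    mem_ball_iff_norm.2 (by linarith)
  let Φ : C(Icc (0 : ℝ) b, E) → C(Icc (0 : ℝ) b, E) := fun w =>
    ⟨fun t => volterraMap W f x (IccExtend hb0 w) t,
      (continuous_volterraMap hW hf (hext w)).comp continuous_subtype_val⟩
  have hmaps : MapsTo Φ s s := by
    intro w hw
    have hT' : ∀ t : Icc (0 : ℝ) b, (t : ℝ) ≤ T → Φ w t = u t := by
      intro t ht
      change volterraMap W f x (IccExtend hb0 w) t = u t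
      rw [volterraMap_congr t.2.1 ((hextT w hw).mono (Icc_subset_Icc_right ht)),
        ← hu.2 t ⟨t.2.1, ht⟩]
    refine ⟨hT', fun t ht => ?_⟩
    have h1 : ‖volterraMap W f x (IccExtend hb0 w) t - q t‖ ≤ L * (δ / 2) * (t - T) := by
      refine norm_volterraMap_sub_le_of_eqOn hW hW1 hf (hext w) hu'c hT
        ((hextT w hw).trans hu'eq.symm) (b := b) (fun τ hτ => ?_) ⟨ht, t.2.2⟩
      have h2 := hextb w hw τ hτ
      rw [hu'z τ hτ.1]
      exact (hLz _ (hball h2) _ (Metric.mem_ball_self hδ) τ).trans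
        (mul_le_mul_of_nonneg_left h2 hL.le)
    have h3 : L * (δ / 2) * (t - T) ≤ δ / 4 := by
      have h4 : (t : ℝ) - T ≤ h := by linarith [t.2.2]
      have h5 : L * ((t : ℝ) - T) ≤ 1 / 2 := (mul_le_mul_of_nonneg_left h4 hL.le).trans hhL
      nlinarith
    have h6 := norm_add_le (volterraMap W f x (IccExtend hb0 w) t - q t) (q t - z)
    rw [sub_add_sub_cancel] at h6
    change ‖volterraMap W f x (IccExtend hb0 w) t - z‖ ≤ δ / 2
    linarith [hqz t ⟨ht, t.2.2⟩]
  have hcontr : ContractingWith (1 / 2) (hmaps.restrict Φ s s) := by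
    refine ⟨by norm_num, LipschitzWith.of_dist_le_mul fun w₁ w₂ => ?_⟩
    rw [Subtype.dist_eq, Subtype.dist_eq]
    change dist (Φ w₁.1) (Φ w₂.1) ≤ _
    rw [ContinuousMap.dist_le (by positivity)]
    intro t
    have hd : ∀ τ ∈ Icc T b, ‖f τ (IccExtend hb0 w₁.1 τ) - f τ (IccExtend hb0 w₂.1 τ)‖ ≤
        L * dist w₁.1 w₂.1 := by
      intro τ hτ
      refine (hLz _ (hball (hextb _ w₁.2 τ hτ)) _ (hball (hextb _ w₂.2 τ hτ)) τ).trans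
        (mul_le_mul_of_nonneg_left ?_ hL.le)
      rw [← dist_eq_norm]
      exact ContinuousMap.dist_apply_le_dist _
    rcases le_total (t : ℝ) T with ht | ht
    · have h1 := (hmaps w₁.2).1 t ht
      have h2 := (hmaps w₂.2).1 t ht
      rw [h1, h2, dist_self]
      positivity
    · have h1 := norm_volterraMap_sub_le_of_eqOn (x := x) hW hW1 hf (hext w₁.1) (hext w₂.1) hT
        ((hextT _ w₁.2).trans (hextT _ w₂.2).symm) hd (t := t) ⟨ht, t.2.2⟩
      rw [← dist_eq_norm] at h1
      refine h1.trans ?_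
      have h4 : (t : ℝ) - T ≤ h := by linarith [t.2.2]
      have h5 : L * ((t : ℝ) - T) ≤ 1 / 2 := (mul_le_mul_of_nonneg_left h4 hL.le).trans hhL
      have h6 : (0 : ℝ) ≤ dist w₁.1 w₂.1 := dist_nonneg
      have h7 : ((1 / 2 : NNReal) : ℝ) = 1 / 2 := by norm_num
      rw [h7]
      nlinarith
  have hmem : (⟨fun t => u' t, hu'c.comp continuous_subtype_val⟩ : C(Icc (0 : ℝ) b, E)) ∈ s := by
    refine ⟨fun t ht => hu'eq ⟨t.2.1, ht⟩, fun t ht => ?_⟩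
    change ‖u' t - z‖ ≤ δ / 2
    rw [hu'z t ht, sub_self, norm_zero]
    exact (half_pos hδ).le
  obtain ⟨w, hw, hfix, -⟩ := ContractingWith.exists_fixedPoint' hsc.isComplete hmaps hcontr hmem
    (edist_ne_top _ _)
  refine ⟨b, by linarith, IccExtend hb0 w, hext w, fun t ht => ?_⟩
  rw [IccExtend_of_mem hb0 w ht]
  exact (congrArg (fun g : C(Icc (0 : ℝ) b, E) => g ⟨t, ht⟩) hfix).symm

open Classical in
/-- The common value at time `t` of all solutions on `[0, t]`. -/
noncomputable def maximalSolution (W : ℝ → E →L[ℝ] E) (f : ℝ → E → E) (x : E) (t : ℝ) : E :=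
  if h : ∃ u, IsVolterraSolution W f x t u then h.choose t else 0

/-- By uniqueness, the separate choices made at different times are consistent. -/
theorem IsVolterraSolution.maximalSolution_eqOn (hW : Continuous fun p : ℝ × E => W p.1 p.2)
    (hW1 : ∀ t x, ‖W t x‖ ≤ ‖x‖) (hf : Continuous fun p : ℝ × E => f p.1 p.2)
    (hLip : UniformlyLocallyLipschitz f) (hu : IsVolterraSolution W f x T u) :
    EqOn (maximalSolution W f x) u (Icc 0 T) := by
  intro t ht
  have hex : ∃ u, IsVolterraSolution W f x t u := ⟨u, hu.mono ht.2⟩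
  rw [maximalSolution, dif_pos hex]
  exact hex.choose_spec.eqOn hW hW1 hf hLip (hu.mono ht.2) (right_mem_Icc.2 ht.1)

theorem continuousOn_maximalSolution (hW : Continuous fun p : ℝ × E => W p.1 p.2)
    (hW1 : ∀ t x, ‖W t x‖ ≤ ‖x‖) (hf : Continuous fun p : ℝ × E => f p.1 p.2)
    (hLip : UniformlyLocallyLipschitz f) {J : Set ℝ} (hJ : J ⊆ Ici 0)
    (h : ∀ t ∈ J, ∃ T > t, ∃ u, IsVolterraSolution W f x T u) :
    ContinuousOn (maximalSolution W f x) J := by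
  intro t ht
  obtain ⟨T, hT, u, hu⟩ := h t ht
  have heq := hu.maximalSolution_eqOn hW hW1 hf hLip
  refine hu.1.continuousWithinAt.congr_of_eventuallyEq ?_ (heq ⟨hJ ht, (hT : t < T).le⟩)
  filter_upwards [self_mem_nhdsWithin, mem_nhdsWithin_of_mem_nhds (Iio_mem_nhds hT)] with s hs hs'
  exact heq ⟨hJ hs, (mem_Iio.1 hs').le⟩

/-- No blow-up: the a priori bound keeps the forcing term bounded on `[0, T)`, so the integral
formula defines a function that is continuous up to `T`. -/
theorem exists_isVolterraSolution_of_forall_lt (hW : Continuous fun p : ℝ × E => W p.1 p.2)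
    (hW1 : ∀ t x, ‖W t x‖ ≤ ‖x‖) (hf : Continuous fun p : ℝ × E => f p.1 p.2)
    (hLip : UniformlyLocallyLipschitz f) {c : ℝ} (hc : 0 ≤ c)
    (hgrow : ∀ t y, ‖f t y‖ ≤ c * (1 + ‖y‖)) (hT : 0 < T)
    (h : ∀ t ∈ Ico 0 T, ∃ u, IsVolterraSolution W f x t u) :
    ∃ u, IsVolterraSolution W f x T u := by
  set m := maximalSolution W f x with hm
  set M := (‖x‖ + c * T) * Real.exp (c * T) with hM
  have hM0 : 0 ≤ M := by positivity
  have hmc : ContinuousOn m (Ico 0 T) := by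
    refine continuousOn_maximalSolution hW hW1 hf hLip (fun t ht => ht.1) fun t ht => ?_
    exact ⟨(t + T) / 2, by linarith [ht.2], h _ ⟨by linarith [ht.1], by linarith [ht.2]⟩⟩
  have hmM : ∀ t ∈ Ico 0 T, ‖m t‖ ≤ M := by
    intro t ht
    obtain ⟨u, hu⟩ := h t ht
    rw [hm, hu.maximalSolution_eqOn hW hW1 hf hLip (right_mem_Icc.2 ht.1)]
    refine (hu.norm_le hW hW1 hf hc hgrow t (right_mem_Icc.2 ht.1)).trans ?_
    have h1 : c * t ≤ c * T := mul_le_mul_of_nonneg_left ht.2.le hc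
    rw [hM]
    gcongr
  -- Cutting off at `T` avoids any claim about `m T`. The forcing is then merely measurable and
  -- bounded, which suffices for `v`, and the single point `T` is negligible in the integral.
  set φ : ℝ → E := (Ico 0 T).indicator fun τ => f τ (m τ) with hφ
  have hφm : AEStronglyMeasurable φ volume := by
    rw [hφ, aestronglyMeasurable_indicator_iff measurableSet_Ico]
    exact (hf.comp_continuousOn (continuousOn_id.prodMk hmc)).aestronglyMeasurable
      measurableSet_Ico
  have hφb : ∀ τ, ‖φ τ‖ ≤ c * (1 + M) := by
    intro τ
    by_cases hτ : τ ∈ Ico 0 T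
    · rw [hφ, indicator_of_mem hτ]
      exact (hgrow _ _).trans (mul_le_mul_of_nonneg_left (by linarith [hmM τ hτ]) hc)
    · rw [hφ, indicator_of_notMem hτ, norm_zero]
      positivity
  set v : ℝ → E := fun t => W t x + ∫ τ in (0 : ℝ)..t, W (t - τ) (φ τ) with hv
  have hvc : Continuous v := by
    refine (hW.comp (continuous_id.prodMk continuous_const)).add ?_
    rw [continuous_iff_continuousAt]
    intro t
    have := intervalIntegral.continuousAt_parametric_primitive_of_dominated (μ := volume)
      (F := fun t τ => W (t - τ) (φ τ)) (fun _ => c * (1 + M)) (min 0 t - 1) (max 0 t + 1)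
      (a₀ := 0) (b₀ := t) (x₀ := t)
      (fun s => (hW.comp_aestronglyMeasurable
        ((by fun_prop : Continuous fun τ => s - τ).aestronglyMeasurable.prodMk hφm)).restrict)
      (Eventually.of_forall fun s => Eventually.of_forall fun τ => (hW1 _ _).trans (hφb τ))
      intervalIntegrable_const
      (Eventually.of_forall fun τ => (hW.comp ((by fun_prop : Continuous fun s => s - τ).prodMk
        continuous_const)).continuousAt)
      ⟨by linarith [min_le_left 0 t], by linarith [le_max_left 0 t]⟩
      ⟨by linarith [min_le_right 0 t], by linarith [le_max_right 0 t]⟩ (by simp)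
    exact ContinuousAt.comp (f := fun s : ℝ => (s, s)) this (by fun_prop)
  have hmv : EqOn m v (Ico 0 T) := by
    intro t ht
    obtain ⟨u, hu⟩ := h t ht
    have heq := hu.maximalSolution_eqOn hW hW1 hf hLip
    rw [hm, heq (right_mem_Icc.2 ht.1), hu.2 t (right_mem_Icc.2 ht.1),
      ← volterraMap_congr ht.1 heq, hv, volterraMap]
    congr 1
    refine intervalIntegral.integral_congr fun τ hτ => ?_
    rw [uIcc_of_le ht.1] at hτ
    simp only [hφ, indicator_of_mem (show τ ∈ Ico 0 T from ⟨hτ.1, hτ.2.trans_lt ht.2⟩), hm]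
  refine ⟨v, hvc, fun t ht => ?_⟩
  change W t x + (∫ τ in (0 : ℝ)..t, W (t - τ) (φ τ)) =
    W t x + ∫ τ in (0 : ℝ)..t, W (t - τ) (f τ (v τ))
  refine congrArg (W t x + ·) (intervalIntegral.integral_congr_ae ?_)
  filter_upwards [compl_mem_ae_iff.2 (measure_singleton T)] with τ hτT hτ
  rw [uIoc_of_le ht.1] at hτ
  have hτ' : τ ∈ Ico 0 T := ⟨hτ.1.le, lt_of_le_of_ne (hτ.2.trans ht.2) hτT⟩
  rw [hφ, indicator_of_mem hτ', hmv hτ']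

variable [CompleteSpace E]

theorem exists_isVolterraSolution (hW : Continuous fun p : ℝ × E => W p.1 p.2)
    (hW1 : ∀ t x, ‖W t x‖ ≤ ‖x‖) (hf : Continuous fun p : ℝ × E => f p.1 p.2)
    (hLip : UniformlyLocallyLipschitz f) {c : ℝ} (hc : 0 ≤ c)
    (hgrow : ∀ t y, ‖f t y‖ ≤ c * (1 + ‖y‖)) (hT : 0 ≤ T) (x : E) :
    ∃ u, IsVolterraSolution W f x T u := by
  set s : Set ℝ := {t | ∃ u, IsVolterraSolution W f x t u} with hs
  have hmono : ∀ t ∈ s, ∀ t' ≤ t, t' ∈ s := fun t ⟨u, hu⟩ t' ht' => ⟨u, hu.mono ht'⟩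
  have h0 : (0 : ℝ) ∈ s := by
    refine ⟨fun _ => W 0 x, continuous_const, fun t ht => ?_⟩
    have : t = 0 := le_antisymm ht.2 ht.1
    simp [volterraMap, this]
  have hclosed : IsClosed (s ∩ Icc 0 T) := by
    refine isClosed_of_closure_subset fun t ht => ?_
    have htI : t ∈ Icc 0 T := isClosed_Icc.closure_subset (closure_mono inter_subset_right ht)
    refine ⟨?_, htI⟩
    rcases htI.1.eq_or_lt with h | h
    · rwa [← h]
    · refine exists_isVolterraSolution_of_forall_lt hW hW1 hf hLip hc hgrow h fun t' ht' => ?_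
      obtain ⟨r, hr, hr'⟩ := mem_closure_iff.1 ht (Ioi t') isOpen_Ioi ht'.2
      exact hmono r hr'.1 t' (mem_Ioi.1 hr).le
  -- Continuous induction: the set of solvable times is closed in `[0, T]` and can be prolonged to
  -- the right of each of its points.
  have := hclosed.Icc_subset_of_forall_exists_gt h0 fun t ht y hy => by
    obtain ⟨u, hu⟩ := ht.1
    obtain ⟨b, hb, v, hv⟩ := hu.exists_extension hW hW1 hf hLip ht.2.1
    exact ⟨min b y, ⟨v, hv.mono (min_le_left _ _)⟩, lt_min hb hy, min_le_right _ _⟩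
  exact this (right_mem_Icc.2 hT)

theorem exists_volterraSolution_halfLine (hW : Continuous fun p : ℝ × E => W p.1 p.2)
    (hW1 : ∀ t x, ‖W t x‖ ≤ ‖x‖) (hf : Continuous fun p : ℝ × E => f p.1 p.2)
    (hLip : UniformlyLocallyLipschitz f) {c : ℝ} (hc : 0 ≤ c)
    (hgrow : ∀ t y, ‖f t y‖ ≤ c * (1 + ‖y‖)) (x : E) :
    ∃ u : ℝ → E, ContinuousOn u (Ici 0) ∧ ∀ t ∈ Ici (0 : ℝ), u t = volterraMap W f x u t := by
  have h : ∀ T : ℝ, 0 ≤ T → ∃ u, IsVolterraSolution W f x T u := fun T hT =>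
    exists_isVolterraSolution hW hW1 hf hLip hc hgrow hT x
  refine ⟨maximalSolution W f x, continuousOn_maximalSolution hW hW1 hf hLip subset_rfl
    fun t ht => ⟨t + 1, by simp, h _ (by linarith [mem_Ici.1 ht])⟩, fun t ht => ?_⟩
  obtain ⟨u, hu⟩ := h t ht
  have heq := hu.maximalSolution_eqOn hW hW1 hf hLip
  rw [volterraMap_congr ht heq, heq (right_mem_Icc.2 ht), ← hu.2 t (right_mem_Icc.2 ht)]

end Volterra

/-! ### Continuous dependence on initial point and parameter. -/

section ContinuousDependence

variable {E : Type*} [NormedAddCommGroup E] [NormedSpace ℝ E]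

theorem continuous_volterraSolution {X : Type*} [TopologicalSpace X] {V : X → ℝ → E →L[ℝ] E}
    (hV : Continuous fun p : X × ℝ × E => V p.1 p.2.1 p.2.2) (hV1 : ∀ lam t x, ‖V lam t x‖ ≤ ‖x‖)
    {F : ℝ × E × X → E} (hF : Continuous F)
    (hLip : UniformlyLocallyLipschitz fun (i : ℝ × X) y => F (i.1, y, i.2)) {T : ℝ} (hT : 0 ≤ T)
    {u : E × X → C(Icc (0 : ℝ) T, E)}
    (hu : ∀ p, IsVolterraSolution (V p.2) (fun t y => F (t, y, p.2)) p.1 T (IccExtend hT (u p))) :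
    Continuous u := by
  rw [continuous_iff_continuousAt]
  intro p₀
  set v : ℝ → E := IccExtend hT (u p₀) with hv
  have hvc : Continuous v := (hu p₀).1
  -- One application of the integral operator with data `p` to the fixed solution `v` for `p₀`.
  -- Currying turns joint continuity into uniform convergence on `[0, T]`, and `dist (w p) (w p₀)`
  -- is the initial error fed into Grönwall's inequality.
  let w : C(E × X, C(Icc (0 : ℝ) T, E)) := ContinuousMap.curry
    ⟨fun q : (E × X) × Icc (0 : ℝ) T =>
      volterraMap (V q.1.2) (fun t y => F (t, y, q.1.2)) q.1.1 v q.2, by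
        refine (hV.comp (by fun_prop :
          Continuous fun q : (E × X) × Icc (0 : ℝ) T => (q.1.2, (q.2 : ℝ), q.1.1))).add ?_
        refine intervalIntegral.continuous_parametric_intervalIntegral_of_continuous
          (f := fun (q : (E × X) × Icc (0 : ℝ) T) τ =>
            V q.1.2 (q.2 - τ) (F (τ, v τ, q.1.2))) ?_ (by fun_prop)
        exact hV.comp (by fun_prop : Continuous fun r : ((E × X) × Icc (0 : ℝ) T) × ℝ =>
          (r.1.1.2, (r.1.2 : ℝ) - r.2, F (r.2, v r.2, r.1.1.2)))⟩
  have hw : ∀ p t, w p t = volterraMap (V p.2) (fun t y => F (t, y, p.2)) p.1 v t := fun p t => rfl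
  have hw0 : w p₀ = u p₀ := by
    ext t
    rw [hw, ← (hu p₀).2 t t.2, IccExtend_of_mem hT _ t.2]
  obtain ⟨δ, hδ, L, hL, hδL⟩ := hLip.exists_of_isCompact
    ((isCompact_Icc (a := 0) (b := T)).image hvc)
  have hη : Tendsto (fun p => dist (w p) (w p₀) * Real.exp (L * T)) (𝓝 p₀) (𝓝 0) := by
    have := ((w.continuous.tendsto p₀).dist (tendsto_const_nhds (x := w p₀))).mul_const
      (Real.exp (L * T))
    rwa [dist_self, zero_mul] at this
  rw [ContinuousAt, tendsto_iff_dist_tendsto_zero]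
  refine squeeze_zero' (Eventually.of_forall fun _ => dist_nonneg) ?_ hη
  filter_upwards [hη.eventually (gt_mem_nhds hδ)] with p hp
  have hVp : Continuous fun r : ℝ × E => V p.2 r.1 r.2 :=
    hV.comp (by fun_prop : Continuous fun r : ℝ × E => (p.2, r.1, r.2))
  have hFp : Continuous fun r : ℝ × E => F (r.1, r.2, p.2) :=
    hF.comp (by fun_prop : Continuous fun r : ℝ × E => (r.1, r.2, p.2))
  have key := norm_sub_le_of_norm_sub_le_add_integral (T := T) (f := fun t y => F (t, y, p.2))
    hFp (hu p).1 hvc hL dist_nonneg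
    (fun t ht z hz => hδL _ (mem_image_of_mem v ht) z hz (t, p.2)) hp
    (fun t ht => by
      have h1 := norm_volterraMap_sub_le (x := p.1) (f := fun t y => F (t, y, p.2)) hVp
        (hV1 p.2) hFp (hu p).1 hvc ht.1
      rw [← (hu p).2 t ht] at h1
      have h2 : ‖w p ⟨t, ht⟩ - v t‖ ≤ dist (w p) (w p₀) := by
        rw [hv, IccExtend_of_mem hT _ ht, ← hw0, ← dist_eq_norm]
        exact ContinuousMap.dist_apply_le_dist _
      rw [hw] at h2
      have h3 := norm_add_le (IccExtend hT (u p) t -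
        volterraMap (V p.2) (fun t y => F (t, y, p.2)) p.1 v t)
        (volterraMap (V p.2) (fun t y => F (t, y, p.2)) p.1 v t - v t)
      rw [sub_add_sub_cancel] at h3
      linarith)
  rw [ContinuousMap.dist_le (by positivity)]
  intro t
  have := key t t.2
  rwa [hv, IccExtend_of_mem hT _ t.2, IccExtend_of_mem hT _ t.2, ← dist_eq_norm] at this

end ContinuousDependence

/-! ### The Hausdorff measure of noncompactness and integration. -/

section MeasureOfNoncompactness

variable {E : Type*} [NormedAddCommGroup E]

theorem hausdorffMNC_le {Ω s : Set E} {r : ℝ} (hr : 0 < r) (hs : s.Finite)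
    (h : Ω ⊆ ⋃ c ∈ s, Metric.ball c r) : hausdorffMNC Ω ≤ ENNReal.ofReal r :=
  iInf₂_le r ⟨hr, s, hs, h⟩

theorem hausdorffMNC_mono {Ω Ω' : Set E} (h : Ω ⊆ Ω') : hausdorffMNC Ω ≤ hausdorffMNC Ω' :=
  le_iInf₂ fun _ ⟨hr, _, hs, hs'⟩ => hausdorffMNC_le hr hs (h.trans hs')

theorem hausdorffMNC_le_of_forall_norm_le {Ω : Set E} {M : ℝ} (h : ∀ x ∈ Ω, ‖x‖ ≤ M) :
    hausdorffMNC Ω ≤ ENNReal.ofReal (|M| + 1) := by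
  refine hausdorffMNC_le (by positivity) (finite_singleton (0 : E)) fun x hx => ?_
  simp only [mem_singleton_iff, iUnion_iUnion_eq_left, mem_ball_zero_iff]
  linarith [h x hx, le_abs_self M]

theorem hausdorffMNC_ne_top {Ω : Set E} (h : Bornology.IsBounded Ω) : hausdorffMNC Ω ≠ ⊤ := by
  obtain ⟨M, hM⟩ := h.exists_norm_le
  exact ((hausdorffMNC_le_of_forall_norm_le hM).trans_lt ENNReal.ofReal_lt_top).ne

theorem hausdorffMNC_range_add_le {ι : Type*} (a b : ι → E) :
    hausdorffMNC (range fun i => a i + b i) ≤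
      hausdorffMNC (range a) + hausdorffMNC (range b) := by
  refine ENNReal.le_iInf_add_iInf fun r r' => ENNReal.le_iInf_add_iInf ?_
  rintro ⟨hr, s, hs, h⟩ ⟨hr', s', hs', h'⟩
  rw [← ENNReal.ofReal_add hr.le hr'.le]
  refine hausdorffMNC_le (add_pos hr hr') (hs.image2 (· + ·) hs') ?_
  rintro _ ⟨i, rfl⟩
  obtain ⟨c, hc, hcr⟩ := mem_iUnion₂.1 (h (mem_range_self i))
  obtain ⟨c', hc', hcr'⟩ := mem_iUnion₂.1 (h' (mem_range_self i))
  refine mem_iUnion₂.2 ⟨c + c', mem_image2_of_mem hc hc', ?_⟩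
  exact (dist_add_add_le _ _ _ _).trans_lt (add_lt_add hcr hcr')

/-- The index set may be uncountable; lower semicontinuity survives arbitrary suprema and still
gives measurability. -/
theorem measurable_iSup_infEDist {ι : Type*} {f : ι → ℝ → E} (hf : ∀ i, Continuous (f i))
    (s : Set E) : Measurable fun τ => ⨆ i, Metric.infEDist (f i τ) s :=
  (lowerSemicontinuous_iSup fun i =>
    (Metric.continuous_infEDist.comp (hf i)).lowerSemicontinuous).measurable

variable [NormedSpace ℝ E]

/-- The finitely many centres of a cover of `C` sweep out a compact set as `l` varies. A finite
`ε`-net of that set provides centres for radius `a * r + ε`. -/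
theorem hausdorffMNC_image_compact_family_le {X : Type*} [TopologicalSpace X] [CompactSpace X]
    {L : X → E →L[ℝ] E} {a : ℝ} (ha : 0 < a) (hL : ∀ l y, ‖L l y‖ ≤ a * ‖y‖)
    (hLc : ∀ y, Continuous fun l => L l y) (C : Set E) :
    hausdorffMNC ((fun p : X × E => L p.1 p.2) '' (univ ×ˢ C)) ≤
      ENNReal.ofReal a * hausdorffMNC C := by
  have ha0 : ENNReal.ofReal a ≠ 0 := (ENNReal.ofReal_pos.2 ha).ne'
  rw [mul_comm, ← ENNReal.div_le_iff_le_mul (Or.inl ha0) (Or.inl ENNReal.ofReal_ne_top)]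
  refine le_iInf₂ fun r ⟨hr, s, hs, h⟩ => ?_
  rw [ENNReal.div_le_iff_le_mul (Or.inl ha0) (Or.inl ENNReal.ofReal_ne_top), mul_comm]
  refine ENNReal.le_of_forall_pos_le_add fun ε hε _ => ?_
  have hε' : (0 : ℝ) < ε := hε
  have hK : IsCompact (⋃ c ∈ s, range fun l => L l c) :=
    hs.isCompact_biUnion fun c _ => isCompact_range (hLc c)
  obtain ⟨t, ht, htc⟩ := Metric.totallyBounded_iff.1 hK.totallyBounded ε hε'
  rw [← ENNReal.ofReal_mul ha.le, ← ENNReal.ofReal_coe_nnreal,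
    ← ENNReal.ofReal_add (by positivity) hε'.le]
  refine hausdorffMNC_le (by positivity) ht ?_
  rintro _ ⟨⟨l, y⟩, ⟨-, hy⟩, rfl⟩
  obtain ⟨c, hc, hcr⟩ := mem_iUnion₂.1 (h hy)
  obtain ⟨z, hz, hzr⟩ := mem_iUnion₂.1 (htc (mem_iUnion₂.2 ⟨c, hc, mem_range_self l⟩))
  refine mem_iUnion₂.2 ⟨z, hz, (dist_triangle _ (L l c) _).trans_lt (add_lt_add_of_le_of_lt ?_ hzr)⟩
  rw [dist_eq_norm, ← map_sub]
  refine (hL l _).trans (mul_le_mul_of_nonneg_left ?_ ha.le)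
  rw [← dist_eq_norm]
  exact (Metric.mem_ball.1 hcr).le

/-- Near-best approximations in `V` of a bounded family stay in a ball of `V`, which is compact. -/
theorem hausdorffMNC_le_iSup_infEDist {ι : Type*} {a : ι → E} {M : ℝ} (ha : ∀ i, ‖a i‖ ≤ M)
    (V : Submodule ℝ E) [FiniteDimensional ℝ V] :
    hausdorffMNC (range a) ≤ ⨆ i, Metric.infEDist (a i) (V : Set E) := by
  set d := ⨆ i, Metric.infEDist (a i) (V : Set E) with hd
  refine ENNReal.le_of_forall_pos_le_add fun ε hε hfin => ?_
  have hε' : (0 : ℝ) < ε := hε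
  set r := d.toReal with hr
  have hdr : d = ENNReal.ofReal r := (ENNReal.ofReal_toReal hfin.ne).symm
  have hr0 : 0 ≤ r := ENNReal.toReal_nonneg
  have hK : IsCompact ((↑) '' Metric.closedBall (0 : V) (M + (r + ε / 2)) : Set E) :=
    (isCompact_closedBall _ _).image continuous_subtype_val
  obtain ⟨t, ht, htc⟩ := Metric.totallyBounded_iff.1 hK.totallyBounded (ε / 2) (by positivity)
  rw [hdr, ← ENNReal.ofReal_coe_nnreal, ← ENNReal.ofReal_add hr0 hε'.le]
  refine hausdorffMNC_le (by positivity) ht ?_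
  rintro _ ⟨i, rfl⟩
  have h1 : Metric.infEDist (a i) (V : Set E) < ENNReal.ofReal (r + ε / 2) := by
    refine (le_iSup (fun i => Metric.infEDist (a i) (V : Set E)) i).trans_lt ?_
    rw [← hd, hdr]
    exact (ENNReal.ofReal_lt_ofReal_iff (by positivity)).2 (by linarith)
  obtain ⟨y, hy, hyd⟩ := Metric.infEDist_lt_iff.1 h1
  rw [edist_dist, ENNReal.ofReal_lt_ofReal_iff (by positivity)] at hyd
  have hy' : y ∈ ((↑) '' Metric.closedBall (0 : V) (M + (r + ε / 2)) : Set E) := by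
    refine ⟨⟨y, hy⟩, ?_, rfl⟩
    rw [mem_closedBall_zero_iff]
    change ‖y‖ ≤ _
    have h2 := norm_add_le (y - a i) (a i)
    rw [sub_add_cancel, ← dist_eq_norm, dist_comm] at h2
    linarith [ha i]
  obtain ⟨z, hz, hzr⟩ := mem_iUnion₂.1 (htc hy')
  refine mem_iUnion₂.2 ⟨z, hz, (dist_triangle _ y _).trans_lt ?_⟩
  linarith [Metric.mem_ball.1 hzr]

theorem infEDist_submodule_eq_enorm (V : Submodule ℝ E) (x : E) :
    Metric.infEDist x (V : Set E) = ‖V.mkQL x‖ₑ := by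
  have h : ‖V.mkQL x‖ = Metric.infDist x (V : Set E) :=
    QuotientAddGroup.norm_mk (S := V.toAddSubgroup) x
  rw [← ofReal_norm, h, Metric.infDist,
    ENNReal.ofReal_toReal (Metric.infEDist_ne_top ⟨0, V.zero_mem⟩)]

/-- Distance to `V` is the norm in the quotient by `V`, and the quotient map commutes with the
integral. -/
theorem infEDist_intervalIntegral_le [CompleteSpace E] {f : ℝ → E} (hf : Continuous f) (V : Submodule ℝ E)
    [FiniteDimensional ℝ V] {t : ℝ} (ht : 0 ≤ t) :
    Metric.infEDist (∫ τ in (0 : ℝ)..t, f τ) (V : Set E) ≤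
      ∫⁻ τ in Ioc 0 t, Metric.infEDist (f τ) (V : Set E) := by
  have : IsClosed (V : Set E) := V.closed_of_finiteDimensional
  simp only [infEDist_submodule_eq_enorm]
  rw [← V.mkQL.intervalIntegral_comp_comm (hf.intervalIntegrable 0 t),
    intervalIntegral.integral_of_le ht]
  exact enorm_integral_le_lintegral_enorm _

variable [TopologicalSpace.SeparableSpace E]

variable (E) in
/-- An increasing sequence of finite-dimensional subspaces with dense union. -/
noncomputable def exhaustingSubspace (m : ℕ) : Submodule ℝ E :=
  Submodule.span ℝ (TopologicalSpace.denseSeq E '' Iio m)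

theorem exhaustingSubspace_mono : Monotone (exhaustingSubspace E) := fun _ _ h =>
  Submodule.span_mono (image_mono (Iio_subset_Iio h))

instance finiteDimensional_exhaustingSubspace (m : ℕ) :
    FiniteDimensional ℝ (exhaustingSubspace E m) :=
  FiniteDimensional.span_of_finite ℝ ((finite_Iio m).image _)

theorem eventually_infEDist_exhaustingSubspace_lt (x : E) {ε : ℝ} (hε : 0 < ε) :
    ∀ᶠ m in atTop, Metric.infEDist x (exhaustingSubspace E m : Set E) < ENNReal.ofReal ε := by
  obtain ⟨i, hi⟩ := Metric.denseRange_iff.1 (TopologicalSpace.denseRange_denseSeq E) x ε hε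
  filter_upwards [eventually_gt_atTop i] with m hm
  refine Metric.infEDist_lt_iff.2 ⟨_, Submodule.subset_span (mem_image_of_mem _ hm), ?_⟩
  rw [edist_dist]
  exact (ENNReal.ofReal_lt_ofReal_iff hε).2 hi

/-- For the lower bound, the finitely many centres of a cover all lie within `ε` of one subspace of
the exhausting sequence. -/
theorem hausdorffMNC_range_eq {ι : Type*} {a : ι → E} {M : ℝ} (ha : ∀ i, ‖a i‖ ≤ M) :
    hausdorffMNC (range a) =
      ⨅ m, ⨆ i, Metric.infEDist (a i) (exhaustingSubspace E m : Set E) := by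
  refine le_antisymm (le_iInf fun m => hausdorffMNC_le_iSup_infEDist ha _) ?_
  refine le_iInf₂ fun r ⟨hr, s, hs, h⟩ => ENNReal.le_of_forall_pos_le_add fun ε hε _ => ?_
  have hε' : (0 : ℝ) < ε := hε
  obtain ⟨m, hm⟩ := ((eventually_all_finite hs).2 fun c _ =>
    eventually_infEDist_exhaustingSubspace_lt c hε').exists
  refine iInf_le_of_le m (iSup_le fun i => ?_)
  obtain ⟨c, hc, hcr⟩ := mem_iUnion₂.1 (h (mem_range_self i))
  refine Metric.infEDist_le_infEDist_add_edist (y := c) |>.trans ?_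
  rw [add_comm]
  refine add_le_add ?_ ?_
  · rw [edist_dist]
    exact ENNReal.ofReal_le_ofReal (Metric.mem_ball.1 hcr).le
  · exact (hm c hc).le.trans_eq ENNReal.ofReal_coe_nnreal

theorem measurable_hausdorffMNC_range {ι : Type*} {f : ι → ℝ → E} {M : ℝ}
    (hf : ∀ i, Continuous (f i)) (hM : ∀ i τ, ‖f i τ‖ ≤ M) :
    Measurable fun τ => hausdorffMNC (range fun i => f i τ) := by
  simp only [fun τ => hausdorffMNC_range_eq fun i => hM i τ]
  exact Measurable.iInf fun m => measurable_iSup_infEDist hf _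

theorem hausdorffMNC_range_integral_le [CompleteSpace E] {ι : Type*} {f : ι → ℝ → E} {M : ℝ}
    (hf : ∀ i, Continuous (f i)) (hM : ∀ i τ, ‖f i τ‖ ≤ M) {t : ℝ} (ht : 0 ≤ t) :
    hausdorffMNC (range fun i => ∫ τ in (0 : ℝ)..t, f i τ) ≤
      ∫⁻ τ in Ioc 0 t, hausdorffMNC (range fun i => f i τ) := by
  have hI : ∀ i, ‖∫ τ in (0 : ℝ)..t, f i τ‖ ≤ M * |t - 0| := fun i =>
    intervalIntegral.norm_integral_le_of_norm_le_const fun τ _ => hM i τ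
  simp only [hausdorffMNC_range_eq hI, fun τ => hausdorffMNC_range_eq fun i => hM i τ]
  -- Monotone convergence for a decreasing sequence, which requires the first function to have
  -- finite integral; it is bounded by `M` on a bounded interval.
  rw [lintegral_iInf (fun m => measurable_iSup_infEDist hf _)]
  · refine iInf_mono fun m => iSup_le fun i => (infEDist_intervalIntegral_le (hf i) _ ht).trans ?_
    exact lintegral_mono fun τ =>
      le_iSup (fun i => Metric.infEDist (f i τ) (exhaustingSubspace E m : Set E)) i
  · exact fun m n hmn τ => iSup_mono fun i => Metric.infEDist_anti (exhaustingSubspace_mono hmn)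
  · have hb : ∀ τ, ⨆ i, Metric.infEDist (f i τ) (exhaustingSubspace E 0 : Set E) ≤
        ENNReal.ofReal M := fun τ => iSup_le fun i => by
      refine (Metric.infEDist_le_edist_of_mem (exhaustingSubspace E 0).zero_mem).trans ?_
      rw [edist_dist, dist_zero_right]
      exact ENNReal.ofReal_le_ofReal (hM i τ)
    refine ((lintegral_mono hb).trans_lt ?_).ne
    simp [ENNReal.mul_lt_top_iff]

end MeasureOfNoncompactness

/-! ### The compactness estimate. -/

section Compactness

variable {E : Type*} [NormedAddCommGroup E] [NormedSpace ℝ E] [CompleteSpace E]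
  [TopologicalSpace.SeparableSpace E]

theorem hausdorffMNC_volterraSolution_le {X : Type*} [TopologicalSpace X] [CompactSpace X]
    {V : X → ℝ → E →L[ℝ] E} {ω : ℝ}
    (hV : Continuous fun p : X × ℝ × E => V p.1 p.2.1 p.2.2) (hV1 : ∀ lam t x, ‖V lam t x‖ ≤ ‖x‖)
    (hVω : ∀ lam t, 0 ≤ t → ∀ x, ‖V lam t x‖ ≤ Real.exp (-ω * t) * ‖x‖)
    {F : ℝ × E × X → E} (hF : Continuous F) {c k : ℝ} (hc : 0 ≤ c)
    (hgrow : ∀ t y lam, ‖F (t, y, lam)‖ ≤ c * (1 + ‖y‖)) (hk : 0 ≤ k)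
    (hset : ∀ t : ℝ, ∀ C : Set E, Bornology.IsBounded C →
      hausdorffMNC ((fun p : E × X => F (t, p.1, p.2)) '' (C ×ˢ univ)) ≤
        ENNReal.ofReal k * hausdorffMNC C) {T : ℝ} (hT : 0 ≤ T)
    {u : E × X → C(Icc (0 : ℝ) T, E)}
    (hu : ∀ p, IsVolterraSolution (V p.2) (fun t y => F (t, y, p.2)) p.1 T (IccExtend hT (u p)))
    (t : Icc (0 : ℝ) T) {Ω : Set E} (hΩ : Bornology.IsBounded Ω) :
    hausdorffMNC ((fun p : E × X => u p t) '' (Ω ×ˢ univ)) ≤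
      ENNReal.ofReal (Real.exp ((k - ω) * t)) * hausdorffMNC Ω := by
  obtain ⟨M₀, hM₀⟩ := hΩ.exists_norm_le
  set P : Set (E × X) := Ω ×ˢ univ with hP
  set U : P → ℝ → E := fun p => IccExtend hT (u p) with hU
  have hUc : ∀ p, Continuous (U p) := fun p => (hu p).1
  have hVp : ∀ lam, Continuous fun r : ℝ × E => V lam r.1 r.2 := fun lam =>
    hV.comp (by fun_prop : Continuous fun r : ℝ × E => (lam, r.1, r.2))
  have hFp : ∀ lam, Continuous fun r : ℝ × E => F (r.1, r.2, lam) := fun lam =>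
    hF.comp (by fun_prop : Continuous fun r : ℝ × E => (r.1, r.2, lam))
  set M := (M₀ + c * T) * Real.exp (c * T) with hM
  have hUM : ∀ p τ, ‖U p τ‖ ≤ M := by
    intro p τ
    have h1 := (hu p).norm_le (hVp _) (hV1 _) (hFp _) hc (fun t y => hgrow t y _)
      (projIcc 0 T hT τ) (projIcc 0 T hT τ).2
    rw [IccExtend_val] at h1
    refine h1.trans (mul_le_mul_of_nonneg_right ?_ (Real.exp_pos _).le)
    linarith [hM₀ p.1.1 p.2.1]
  set g : ℝ → ℝ≥0∞ := fun τ => hausdorffMNC (range fun p => U p τ) with hg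
  have hgm : Measurable g := measurable_hausdorffMNC_range hUc hUM
  have hgb : ∀ τ, g τ ≤ ENNReal.ofReal (|M| + 1) := fun τ =>
    hausdorffMNC_le_of_forall_norm_le (by rintro _ ⟨p, rfl⟩; exact hUM p τ)
  set B := (hausdorffMNC Ω).toReal with hB
  have hBeq : hausdorffMNC Ω = ENNReal.ofReal B :=
    (ENNReal.ofReal_toReal (hausdorffMNC_ne_top hΩ)).symm
  set G : ℝ → ℝ := fun τ => (g τ).toReal with hG
  have hGeq : ∀ τ, g τ = ENNReal.ofReal (G τ) := fun τ =>
    (ENNReal.ofReal_toReal ((hgb τ).trans_lt ENNReal.ofReal_lt_top).ne).symm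
  have hG0 : ∀ τ, 0 ≤ G τ := fun τ => ENNReal.toReal_nonneg
  have hGb : ∀ τ, G τ ≤ |M| + 1 := fun τ =>
    ENNReal.toReal_le_of_le_ofReal (by positivity) (hgb τ)
  have hGm : Measurable G := hgm.ennreal_toReal
  have hVset : ∀ s, 0 ≤ s → ∀ C : Set E,
      hausdorffMNC ((fun p : X × E => V p.1 s p.2) '' (univ ×ˢ C)) ≤
        ENNReal.ofReal (Real.exp (-ω * s)) * hausdorffMNC C := fun s hs C =>
    hausdorffMNC_image_compact_family_le (Real.exp_pos _) (fun l y => hVω l s hs y)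
      (fun y => hV.comp (by fun_prop : Continuous fun l : X => (l, s, y))) C
  -- The two terms of the integral equation are estimated separately. In both, compactness of the
  -- parameter space lets all semigroups act at once with only the factor `e^{-ω s}` or `e^{-ω (s -
  -- τ)}`.
  have hmain : ∀ s ∈ Icc 0 T, g s ≤ ENNReal.ofReal (Real.exp (-ω * s)) * hausdorffMNC Ω +
      ∫⁻ τ in Ioc 0 s, ENNReal.ofReal (Real.exp (-ω * (s - τ)) * (k * G τ)) := by
    intro s hs
    have h1 : g s = hausdorffMNC (range fun p : P => V p.1.2 s p.1.1 +
        ∫ τ in (0 : ℝ)..s, V p.1.2 (s - τ) (F (τ, U p τ, p.1.2))) := by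
      simp only [hg]
      congr 2
      funext p
      exact (hu p).2 s hs
    rw [h1]
    refine (hausdorffMNC_range_add_le _ _).trans (add_le_add ?_ ?_)
    · refine (hausdorffMNC_mono ?_).trans (hVset s hs.1 Ω)
      rintro _ ⟨p, rfl⟩
      exact ⟨(p.1.2, p.1.1), ⟨mem_univ _, p.2.1⟩, rfl⟩
    · refine (hausdorffMNC_range_integral_le
        (f := fun (p : P) τ => V p.1.2 (s - τ) (F (τ, U p τ, p.1.2))) (M := c * (1 + M))
        (fun p => continuous_volterra_integrand (f := fun t y => F (t, y, p.1.2)) (hVp _) (hFp _)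
          (hUc p) s) (fun p τ => ?_) hs.1).trans ?_
      · exact (hV1 _ _ _).trans ((hgrow _ _ _).trans
          (mul_le_mul_of_nonneg_left (by linarith [hUM p τ]) hc))
      · refine setLIntegral_mono' measurableSet_Ioc fun τ hτ => ?_
        have hbdd : Bornology.IsBounded (range fun p => U p τ) :=
          isBounded_iff_forall_norm_le.2 ⟨M, by rintro _ ⟨p, rfl⟩; exact hUM p τ⟩
        rw [ENNReal.ofReal_mul (Real.exp_pos _).le, ENNReal.ofReal_mul hk, ← hGeq]
        refine le_trans (hausdorffMNC_mono ?_) ((hVset (s - τ) (sub_nonneg.2 hτ.2) _).trans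
          (mul_le_mul_right (hset τ _ hbdd) _))
        rintro _ ⟨p, rfl⟩
        exact ⟨(p.1.2, F (τ, U p τ, p.1.2)), ⟨mem_univ _, (U p τ, p.1.2),
          ⟨mem_range_self p, mem_univ _⟩, rfl⟩, rfl⟩
  have hint : ∀ φ : ℝ → ℝ, Continuous φ → ∀ a b,
      IntervalIntegrable (fun τ => φ τ * G τ) volume a b := by
    intro φ hφ a b
    have : IntervalIntegrable G volume a b :=
      (intervalIntegrable_const (c := |M| + 1)).mono_fun hGm.aestronglyMeasurable
        (Eventually.of_forall fun τ => by
          change ‖G τ‖ ≤ ‖|M| + 1‖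
          rw [Real.norm_of_nonneg (hG0 τ), Real.norm_of_nonneg (by positivity)]
          exact hGb τ)
    exact this.continuousOn_mul hφ.continuousOn
  -- Multiplying by `e^{ω s}` turns the convolution kernel into the constant `k`, the form that
  -- Grönwall's inequality needs.
  have hreal : ∀ s ∈ Icc 0 T, Real.exp (ω * s) * G s ≤
      B + k * ∫ τ in (0 : ℝ)..s, Real.exp (ω * τ) * G τ := by
    intro s hs
    have h1 := hmain s hs
    have hi := hint (fun τ => Real.exp (-ω * (s - τ)) * k) (by fun_prop) 0 s
    have hi' : IntervalIntegrable (fun τ => Real.exp (-ω * (s - τ)) * (k * G τ)) volume 0 s := by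
      simpa only [mul_assoc] using hi
    have hnn : ∀ τ, 0 ≤ Real.exp (-ω * (s - τ)) * (k * G τ) := fun τ =>
      mul_nonneg (Real.exp_pos _).le (mul_nonneg hk (hG0 τ))
    rw [← ofReal_integral_eq_lintegral_ofReal hi'.1 (Eventually.of_forall hnn),
      ← intervalIntegral.integral_of_le hs.1, hBeq, ← ENNReal.ofReal_mul (Real.exp_pos _).le,
      ← ENNReal.ofReal_add (mul_nonneg (Real.exp_pos _).le ENNReal.toReal_nonneg)
        (intervalIntegral.integral_nonneg hs.1 fun τ _ => hnn τ), hGeq,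
      ENNReal.ofReal_le_ofReal_iff (add_nonneg (mul_nonneg (Real.exp_pos _).le
        ENNReal.toReal_nonneg) (intervalIntegral.integral_nonneg hs.1 fun τ _ => hnn τ))] at h1
    have h2 := mul_le_mul_of_nonneg_left h1 (Real.exp_pos (ω * s)).le
    refine h2.trans_eq ?_
    rw [mul_add, ← mul_assoc, ← Real.exp_add, ← intervalIntegral.integral_const_mul,
      ← intervalIntegral.integral_const_mul]
    congr 1
    · rw [show ω * s + -ω * s = 0 by ring, Real.exp_zero, one_mul]
    · congr 1
      funext τ
      rw [← mul_assoc, ← Real.exp_add, show ω * s + -ω * (s - τ) = ω * τ by ring]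
      ring
  have hfin := le_mul_exp_of_le_add_integral hk
    ((intervalIntegrable_iff_integrableOn_Icc_of_le hT).1
      (hint (fun τ => Real.exp (ω * τ)) (by fun_prop) 0 T)) hreal t t.2
  have hGt : G t ≤ Real.exp ((k - ω) * t) * B := by
    have h3 := mul_le_mul_of_nonneg_left hfin (Real.exp_pos (-(ω * t))).le
    rw [← mul_assoc, ← Real.exp_add, neg_add_cancel, Real.exp_zero, one_mul] at h3
    refine h3.trans_eq ?_
    rw [mul_comm B, ← mul_assoc, ← Real.exp_add]
    congr 2
    ring
  have himg : (fun p : E × X => u p t) '' (Ω ×ˢ univ) = range fun p => U p t := by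
    rw [image_eq_range]
    congr 1
    funext p
    exact (IccExtend_val hT (u p) t).symm
  rw [himg, hBeq, ← ENNReal.ofReal_mul (Real.exp_pos _).le]
  exact (hGeq t).trans_le (ENNReal.ofReal_le_ofReal hGt)

end Compactness

/-! ### Reduction of mild solutions to the integral equation on all real times. -/

section MildSolution

variable {E : Type*} [NormedAddCommGroup E] {F : ℝ × E × I → E} {J : Set ℝ}
  {k : ℝ} {r : ℝ → ℝ}

/-- Composing the time variable with a retraction `r` onto `J` extends the perturbation to all real
times without changing it on `J`. -/
theorem IsPerturbation.continuous_comp (hF : IsPerturbation F J k) (hr : Continuous r)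
    (hrJ : ∀ t, r t ∈ J) : Continuous fun p : ℝ × E × I => F (r p.1, p.2) :=
  hF.continuousOn.comp_continuous (by fun_prop) fun p => ⟨hrJ p.1, mem_univ _⟩

theorem IsPerturbation.uniformlyLocallyLipschitz_comp (hF : IsPerturbation F J k)
    (hrJ : ∀ t, r t ∈ J) :
    UniformlyLocallyLipschitz fun (i : ℝ × I) (y : E) => F (r i.1, y, i.2) := fun x => by
  obtain ⟨δ, hδ, L, hL, h⟩ := hF.locallyLipschitz x
  exact ⟨δ, hδ, L, hL, fun x₁ h₁ x₂ h₂ i => h x₁ h₁ x₂ h₂ _ (hrJ i.1) i.2⟩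

theorem IsPerturbation.hausdorffMNC_image_le (hF : IsPerturbation F J k) (hrJ : ∀ t, r t ∈ J)
    (t : ℝ) (C : Set E) (hC : Bornology.IsBounded C) :
    hausdorffMNC ((fun p : E × I => F (r t, p.1, p.2)) '' (C ×ˢ univ)) ≤
      ENNReal.ofReal k * hausdorffMNC C := by
  refine (hausdorffMNC_mono ?_).trans (hF.setContraction C hC)
  rintro _ ⟨p, hp, rfl⟩
  exact ⟨(r t, p), ⟨hrJ t, hp⟩, rfl⟩

theorem isMildSolution_iff [NormedSpace ℝ E] {S : ℝ → E →L[ℝ] E} {lam : I} {x : E} {u : ℝ → E}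
    (hJ : ∀ t ∈ J, 0 ≤ t ∧ Icc 0 t ⊆ J) (hr : ∀ t ∈ J, r t = t) :
    IsMildSolution S F lam J x u ↔ ContinuousOn u J ∧
      ∀ t ∈ J, u t = volterraMap (extendSemigroup S) (fun t y => F (r t, y, lam)) x u t := by
  refine and_congr_right fun _ => forall₂_congr fun t ht => ?_
  obtain ⟨ht0, htJ⟩ := hJ t ht
  have h : ∫ τ in (0 : ℝ)..t, extendSemigroup S (t - τ) (F (r τ, u τ, lam)) =
      ∫ τ in (0 : ℝ)..t, S (t - τ) (F (τ, u τ, lam)) := by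
    refine intervalIntegral.integral_congr fun τ hτ => ?_
    rw [uIcc_of_le ht0] at hτ
    simp only [extendSemigroup_of_nonneg (sub_nonneg.2 hτ.2), hr τ (htJ hτ)]
  rw [volterraMap, extendSemigroup_of_nonneg ht0, h]

end MildSolution

end EvolutionFamily

open EvolutionFamily

theorem mainTheorem9 {E : Type*} [NormedAddCommGroup E] [NormedSpace ℝ E] [CompleteSpace E]
    [TopologicalSpace.SeparableSpace E]
    (A : I → E →ₗ.[ℝ] E) (S : I → ℝ → E →L[ℝ] E) (ω : ℝ)
    (hdense : ∀ lam : I, Dense ((A lam).domain : Set E))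
    (hS : ∀ lam : I, EvolutionFamily.IsC0Semigroup (S lam))
    (hgen : ∀ lam : I, EvolutionFamily.IsInfinitesimalGenerator (-(A lam)) (S lam))
    (hω : 0 < ω)
    (hcontr : ∀ lam : I, ∀ t : ℝ, 0 ≤ t → ‖S lam t‖ ≤ Real.exp (-ω * t))
    (hres : EvolutionFamily.ResolventContinuous A ω) :
    (∀ (T : ℝ) (hT : 0 < T) (F : ℝ × E × I → E) (k : ℝ),
      EvolutionFamily.IsPerturbation F (Icc 0 T) k →
      ∃ u : E × I → C(Icc (0 : ℝ) T, E),
        -- existence and uniqueness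
        (∀ (x : E) (lam : I) (v : C(Icc (0 : ℝ) T, E)),
          EvolutionFamily.IsMildSolution (S lam) F lam (Icc 0 T) x (IccExtend hT.le v) ↔
            v = u (x, lam)) ∧
        -- continuous dependence
        (∀ (x : ℕ → E) (l : ℕ → I) (x₀ : E) (l₀ : I),
          Tendsto (fun n => (x n, l n)) atTop (𝓝 (x₀, l₀)) →
            Tendsto (fun n => u (x n, l n)) atTop (𝓝 (u (x₀, l₀)))) ∧
        -- compactness of the translation operator
        (∀ (t : Icc (0 : ℝ) T) (Ω : Set E), Bornology.IsBounded Ω →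
          EvolutionFamily.hausdorffMNC ((fun p : E × I => u p t) '' (Ω ×ˢ univ)) ≤
            ENNReal.ofReal (Real.exp ((k - ω) * t)) * EvolutionFamily.hausdorffMNC Ω)) ∧
    -- existence and uniqueness on the half-line
    (∀ (F : ℝ × E × I → E) (k : ℝ), EvolutionFamily.IsPerturbation F (Ici 0) k →
      ∀ (x : E) (lam : I), ∃! u : C(Ici (0 : ℝ), E),
        EvolutionFamily.IsMildSolution (S lam) F lam (Ici 0) x (IciExtend u)) := by
  have hV := continuous_semigroupFamily_of_resolventContinuous hS hgen hω hcontr hres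
  have hV1 : ∀ lam t x, ‖extendSemigroup (S lam) t x‖ ≤ ‖x‖ := fun lam =>
    norm_extendSemigroup_apply_le hω (hcontr lam)
  have hVp : ∀ lam, Continuous fun p : ℝ × E => extendSemigroup (S lam) p.1 p.2 := fun lam =>
    continuous_extendSemigroup_uncurry (hS lam) hω (hcontr lam)
  refine ⟨fun T hT F k hF => ?_, fun F k hF x lam => ?_⟩
  · set r : ℝ → ℝ := fun t => projIcc 0 T hT.le t with hr
    have hrJ : ∀ t, r t ∈ Icc 0 T := fun t => (projIcc 0 T hT.le t).2
    have hrc : Continuous r := continuous_subtype_val.comp continuous_projIcc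
    have hr' : ∀ t ∈ Icc 0 T, r t = t := fun t ht => by rw [hr]; simp [projIcc_of_mem hT.le ht]
    have hJ : ∀ t ∈ Icc 0 T, 0 ≤ t ∧ Icc 0 t ⊆ Icc 0 T := fun t ht =>
      ⟨ht.1, Icc_subset_Icc_right ht.2⟩
    have hFc := hF.continuous_comp hrc hrJ
    have hFp : ∀ lam, Continuous fun p : ℝ × E => F (r p.1, p.2, lam) := fun lam =>
      hFc.comp (by fun_prop : Continuous fun p : ℝ × E => (p.1, p.2, lam))
    have hLip := hF.uniformlyLocallyLipschitz_comp hrJ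
    have hLipp : ∀ lam, UniformlyLocallyLipschitz fun t y => F (r t, y, lam) := fun lam x => by
      obtain ⟨δ, hδ, L, hL, h⟩ := hLip x
      exact ⟨δ, hδ, L, hL, fun x₁ h₁ x₂ h₂ t => h x₁ h₁ x₂ h₂ (t, lam)⟩
    obtain ⟨c, hc, hgrow⟩ := hF.linearGrowth
    have hiff : ∀ (x : E) (lam : I) (v : C(Icc (0 : ℝ) T, E)),
        IsMildSolution (S lam) F lam (Icc 0 T) x (IccExtend hT.le v) ↔
        IsVolterraSolution (extendSemigroup (S lam)) (fun t y => F (r t, y, lam)) x T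
          (IccExtend hT.le v) := fun x lam v => by
      have hvc : Continuous (IccExtend hT.le v) := v.continuous.Icc_extend'
      rw [isMildSolution_iff hJ hr']
      exact ⟨fun h => ⟨hvc, h.2⟩, fun h => ⟨hvc.continuousOn, h.2⟩⟩
    choose w hw using fun p : E × I => exists_isVolterraSolution (hVp p.2) (hV1 p.2) (hFp p.2)
      (hLipp p.2) hc.le (fun t y => hgrow y (r t) (hrJ t) p.2) hT.le p.1
    set u : E × I → C(Icc (0 : ℝ) T, E) := fun p =>
      ⟨fun t => w p t, (hw p).1.comp continuous_subtype_val⟩ with hu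
    have huw : ∀ p, EqOn (IccExtend hT.le (u p)) (w p) (Icc 0 T) := fun p t ht =>
      IccExtend_of_mem hT.le _ ht
    have husol : ∀ p, IsVolterraSolution (extendSemigroup (S p.2))
        (fun t y => F (r t, y, p.2)) p.1 T (IccExtend hT.le (u p)) := fun p =>
      ⟨(u p).continuous.Icc_extend', fun t ht => by
        rw [huw p ht, (hw p).2 t ht,
          volterraMap_congr ht.1 ((huw p).mono (Icc_subset_Icc_right ht.2))]⟩
    refine ⟨u, fun x lam v => ?_, fun x l x₀ l₀ h => ?_, fun t Ω hΩ => ?_⟩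
    · rw [hiff]
      constructor
      · intro hv
        ext t
        have := hv.eqOn (hVp lam) (hV1 lam) (hFp lam) (hLipp lam) (husol (x, lam)) t.2
        rwa [IccExtend_val, IccExtend_val] at this
      · rintro rfl
        exact husol (x, lam)
    · exact ((continuous_volterraSolution hV hV1 hFc hLip hT.le husol).tendsto _).comp h
    · exact hausdorffMNC_volterraSolution_le hV hV1
        (fun lam t ht x => by
          rw [extendSemigroup_of_nonneg ht]
          exact (S lam t).le_of_opNorm_le (hcontr lam t ht) x)
        hFc hc.le (fun t y lam => hgrow y (r t) (hrJ t) lam) hF.k_nonneg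
        (hF.hausdorffMNC_image_le hrJ) hT.le husol t hΩ
  · set r : ℝ → ℝ := fun t => max t 0 with hr
    have hrJ : ∀ t, r t ∈ Ici (0 : ℝ) := fun t => le_max_right t 0
    have hrc : Continuous r := by fun_prop
    have hr' : ∀ t ∈ Ici (0 : ℝ), r t = t := fun t ht => max_eq_left ht
    have hJ : ∀ t ∈ Ici (0 : ℝ), 0 ≤ t ∧ Icc 0 t ⊆ Ici 0 := fun t ht =>
      ⟨ht, Icc_subset_Ici_self⟩
    have hFp : Continuous fun p : ℝ × E => F (r p.1, p.2, lam) :=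
      (hF.continuous_comp hrc hrJ).comp (by fun_prop : Continuous fun p : ℝ × E => (p.1, p.2, lam))
    have hLip : UniformlyLocallyLipschitz fun t y => F (r t, y, lam) := fun x => by
      obtain ⟨δ, hδ, L, hL, h⟩ := hF.uniformlyLocallyLipschitz_comp hrJ x
      exact ⟨δ, hδ, L, hL, fun x₁ h₁ x₂ h₂ t => h x₁ h₁ x₂ h₂ (t, lam)⟩
    obtain ⟨c, hc, hgrow⟩ := hF.linearGrowth
    have hext : ∀ v : C(Ici (0 : ℝ), E), Continuous (IciExtend v) := fun v =>
      v.continuous.comp ((by fun_prop : Continuous fun t : ℝ => max 0 t).subtype_mk _)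
    obtain ⟨w, hwc, hw⟩ := exists_volterraSolution_halfLine (hVp lam) (hV1 lam) hFp hLip hc.le
      (fun t y => hgrow y (r t) (hrJ t) lam) x
    let u : C(Ici (0 : ℝ), E) := ⟨fun t => w t, hwc.domRestrict⟩
    have huw : EqOn (IciExtend u) w (Ici 0) := fun t ht => IciExtend_of_mem _ ht
    have husol : ∀ t ∈ Ici (0 : ℝ), IciExtend u t = volterraMap (extendSemigroup (S lam))
        (fun t y => F (r t, y, lam)) x (IciExtend u) t := fun t ht => by
      rw [huw ht, hw t ht, volterraMap_congr ht (huw.mono Icc_subset_Ici_self)]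
    refine ⟨u, (isMildSolution_iff hJ hr').2 ⟨(hext u).continuousOn, husol⟩, fun v hv => ?_⟩
    have hvsol := ((isMildSolution_iff hJ hr').1 hv).2
    ext t
    -- Uniqueness on the half-line is uniqueness on each `[0, t]`, read off at the endpoint `t`.
    have := IsVolterraSolution.eqOn (T := t) (hVp lam) (hV1 lam) hFp hLip
      ⟨hext v, fun s hs => hvsol s hs.1⟩ ⟨hext u, fun s hs => husol s hs.1⟩
      (right_mem_Icc.2 t.2)
    rwa [IciExtend_coe, IciExtend_coe] at this
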